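/- Let $c\in\mathbb R$ and let $X^2_c$ be the oriented, complete, simply connected surface of constant curvature $c$: the sphere of radius $1/\sqrt c$ in $\mathbb R^3$ if $c>0$, the Euclidean plane if $c=0$, and, if $c<0$, the sheet $u_3>0$ of the hyperboloid $\langle u,u\rangle=1/c$ in $\mathbb R^3$ with the Lorentz product $u_1v_1+u_2v_2-u_3v_3$. Let $\gamma$ be a closed curve on $X^2_c$, not necessarily simple, of length $L>0$, parametrized by arclength $s$ as a continuous $L$-periodic map. Suppose that $\gamma$ is piecewise $C^2$ in the following sense: modulo $L$ it is of class $C^2$ except possibly at finitely many parameters $a_1,\dots,a_N\in[0,L)$ (the singular points), and at each $a_k$ the tangent vector $\gamma'$ has a limit from the left, $T_k^-$, and a limit from the right, $T_k^+$. Let $k_g$ be the signed geodesic curvature of $\gamma$, i.e. the component of $\nabla_{\gamma'}\gamma'$ along the unit vector obtained by rotating $\gamma'$ through $+\pi/2$, and let $\theta_k\in[0,2\pi]$ be the interior angle at $a_k$, i.e. the counterclockwise angle from $T_k^+$ to $-T_k^-$ (the angle on the left of the curve, so that the tangent turns at $a_k$ by $\pi-\theta_k$; at a cusp either value $0$ or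 $2\pi$ may be used). Let $z$ be an orientation-preserving stereographic coordinate on $X^2_c$ centred at a point $O$; it is global if $c\le 0$, while if $c>0$ it is defined off the antipode $-O$, and we assume that $\gamma$ does not pass through $-O$. For $P$ not on $\gamma$, let $\operatorname{Ind}(\gamma,P)$ be the index of the plane curve $z\circ\gamma$ about $z(P)$, that is, $(\psi(L)-\psi(0))/2\pi$ for a continuous branch $\psi$ of the argument of $z(\gamma(s))-z(P)$ on $[0,L]$. Then $\operatorname{Ind}(\gamma,\cdot)$ is integrable on $X^2_c$ for the area element $dS$. Let $$F=\int_{X^2_c}\operatorname{Ind}(\gamma,P)\,dS$$ be the area with multiplicities enclosed by $\gamma$. Then there is an integer $\nu$ such that $$\int_\gamma k_g\,ds=-cF+\sum_{k=1}^N\theta_k+(2\nu-N)\pi .$$ Here the left-hand side converges as an improper integral at the singular points, and it is the ordinary integral $\int_0^L k_g(s)\,ds$ whenever $k_g$ is integrable on $[0,L]$; this is the case in particular if $\gamma''$ also has one-sided limits at all the singular points. -/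

import Mathlib

open MeasureTheory Filter Topology

noncomputable section

namespace ConstCurv

/-- The ambient coordinate space `ℝ³` (only its topology and linear structure are used). -/
abbrev Amb : Type := Fin 3 → ℝ

/-- The scalar product on `ℝ³` with matrix `diag(1, 1, ε)`, where `ε` is the sign of `c`:
Riemannian for `c > 0`, Lorentzian for `c < 0`; for `c = 0` it restricts to the Euclidean
scalar product on the plane `u 2 = 0`. -/
def form (c : ℝ) (u v : Amb) : ℝ :=
  u 0 * v 0 + u 1 * v 1 + Real.sign c * (u 2 * v 2)

/-- The simply connected complete surface of constant curvature `c`: the sphere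
`⟨u, u⟩ = 1/c` for `c > 0`, the upper sheet of the hyperboloid `⟨u, u⟩ = 1/c` for `c < 0`,
the plane `u 2 = 0` for `c = 0`. -/
def surface (c : ℝ) : Set Amb :=
  {u | if c = 0 then u 2 = 0 else form c u u = 1 / c ∧ (c < 0 → 0 < u 2)}

/-- The tangent plane of the surface at the point `p`. -/
def tangentPlane (c : ℝ) (p : Amb) : Set Amb :=
  {v | if c = 0 then v 2 = 0 else form c v p = 0}

/-- The unit normal of the surface at `p` (outward for the sphere, upward otherwise). It fixes
the orientation of the surface. -/
def unitNormal (c : ℝ) (p : Amb) : Amb :=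
  if c = 0 then ![0, 0, 1] else Real.sqrt |c| • p

/-- The area form of the oriented surface at `p`, on tangent vectors `u`, `v`. -/
def areaForm (c : ℝ) (p u v : Amb) : ℝ :=
  Matrix.det (Matrix.of ![u, v, unitNormal c p])

/-- The tangential part at `p` of the derivative `a` of a tangent vector field. For a curve
`γ` on the surface, `∇_{γ'} γ' = γ'' - c ⟨γ'', γ⟩ γ`. -/
def tangentialPart (c : ℝ) (p a : Amb) : Amb :=
  a - (c * form c a p) • p

/-- The (signed) geodesic curvature of a curve parametrized by arclength: the component of
`∇_{γ'} γ'` along the unit tangent vector obtained from `γ'` by rotating it through `+π/2`. -/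
def geodesicCurvature (c : ℝ) (γ : ℝ → Amb) (s : ℝ) : ℝ :=
  areaForm c (γ s) (deriv γ s) (tangentialPart c (γ s) (deriv (deriv γ) s))

/-- `s` is, modulo the period `L`, one of the parameters in `S`. -/
def IsSingularParam (L : ℝ) (S : Finset ℝ) (s : ℝ) : Prop :=
  ∃ a ∈ S, ∃ m : ℤ, s = a + m * L

/-- A function has a limit from the left and a limit from the right at `a`. -/
def HasOneSidedLimits (f : ℝ → Amb) (a : ℝ) : Prop :=
  (∃ v, Tendsto f (𝓝[<] a) (𝓝 v)) ∧ ∃ v, Tendsto f (𝓝[>] a) (𝓝 v)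

/-- `γ` is a closed piecewise `C²` curve on the surface of curvature `c`, of length `L` and
parametrized by arclength, with (at most) the singular parameters `S`. It is given as an
`L`-periodic map; it need not be simple. At the singular parameters only the one-sided limits
of the tangent vector are required to exist. -/
structure IsClosedPiecewiseC2 (c L : ℝ) (S : Finset ℝ) (γ : ℝ → Amb) : Prop where
  length_pos : 0 < L
  mem_surface : ∀ s, γ s ∈ surface c
  continuous : Continuous γ
  periodic : Function.Periodic γ L
  singular_mem : ∀ a ∈ S, a ∈ Set.Ico 0 L
  contDiffAt : ∀ s, ¬ IsSingularParam L S s → ContDiffAt ℝ 2 γ s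
  unit_speed : ∀ s, ¬ IsSingularParam L S s → form c (deriv γ s) (deriv γ s) = 1
  oneSided : ∀ a ∈ S, HasOneSidedLimits (deriv γ) a

/-- `θ` is an interior angle of `γ` at the parameter `a`: the angle from the outgoing unit
tangent vector `Tₒ` counterclockwise to the reversed incoming one `-Tᵢ`, that is, the angle on
the left of the curve. Equivalently, the tangent turns at `a` by the angle `π - θ`.
(At a cusp `Tₒ = -Tᵢ` both values `0` and `2π` are admitted.) -/
def IsInteriorAngle (c : ℝ) (γ : ℝ → Amb) (a θ : ℝ) : Prop :=
  0 ≤ θ ∧ θ ≤ 2 * Real.pi ∧ ∃ Ti To : Amb,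
    Tendsto (deriv γ) (𝓝[<] a) (𝓝 Ti) ∧ Tendsto (deriv γ) (𝓝[>] a) (𝓝 To) ∧
    form c To (-Ti) = Real.cos θ ∧ areaForm c (γ a) To (-Ti) = Real.sin θ

/-- A positively oriented orthonormal frame of the surface at one point. -/
structure Frame (c : ℝ) where
  pt : Amb
  e₁ : Amb
  e₂ : Amb
  pt_mem : pt ∈ surface c
  e₁_mem : e₁ ∈ tangentPlane c pt
  e₂_mem : e₂ ∈ tangentPlane c pt
  e₁_unit : form c e₁ e₁ = 1
  e₂_unit : form c e₂ e₂ = 1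
  orthogonal : form c e₁ e₂ = 0
  positive : 0 < areaForm c pt e₁ e₂

variable {c : ℝ}

/-- The domain in `ℂ = ℝ²` of the stereographic parametrization: a disc of radius `2/√(-c)`
if `c < 0`, the whole plane if `c ≥ 0`. -/
def chartDomain (c : ℝ) : Set ℂ := {w | 0 < 1 + c / 4 * ‖w‖ ^ 2}

/-- The stereographic parametrization of the surface centred at the frame `fr`. It is onto if
`c ≤ 0`, and it misses exactly the antipode `-fr.pt` of the centre if `c > 0`. For `c = 0` it
is the Cartesian parametrization given by the frame, for `c < 0` the Poincaré disc. -/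
def Frame.param (fr : Frame c) (w : ℂ) : Amb :=
  (1 + c / 4 * ‖w‖ ^ 2)⁻¹ •
    ((1 - c / 4 * ‖w‖ ^ 2) • fr.pt + w.re • fr.e₁ + w.im • fr.e₂)

/-- The stereographic coordinate of a point; the inverse of `Frame.param`. (The denominator
vanishes on the surface only at the antipode of the centre, for `c > 0`.) -/
def Frame.coord (fr : Frame c) (p : Amb) : ℂ :=
  (⟨form c (p - fr.pt) fr.e₁, form c (p - fr.pt) fr.e₂⟩ : ℂ) /
    ((1 - c / 4 * form c (p - fr.pt) (p - fr.pt) : ℝ) : ℂ)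

/-- The area measure `dS` of the surface, computed in stereographic coordinates:
`dS = areaForm (φ_u, φ_v) du dv`, where `φ` is the parametrization and `w = u + i v`. -/
def Frame.areaMeasure (fr : Frame c) : Measure Amb :=
  Measure.map fr.param
    ((volume.restrict (chartDomain c)).withDensity fun w =>
      ENNReal.ofReal (areaForm c (fr.param w)
        (fderiv ℝ fr.param w 1) (fderiv ℝ fr.param w Complex.I)))

/-- `ψ` is a continuous branch on `[0, L]` of the argument of `z s - w`, and `w` is not on
the curve `z`. -/
def IsArgBranch (L : ℝ) (z : ℝ → ℂ) (w : ℂ) (ψ : ℝ → ℝ) : Prop :=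
  ContinuousOn ψ (Set.Icc 0 L) ∧ ∀ s ∈ Set.Icc 0 L,
    z s ≠ w ∧ z s - w = ‖z s - w‖ * Complex.exp (ψ s * Complex.I)

open Classical in
/-- The index of the closed plane curve `z` (on `[0, L]`) about `w`: the total variation
`(ψ L - ψ 0) / 2π` of a branch `ψ` of the argument of `z s - w` (value `0` on the curve). -/
def planeIndex (L : ℝ) (z : ℝ → ℂ) (w : ℂ) : ℝ :=
  if h : ∃ ψ, IsArgBranch L z w ψ then (h.choose L - h.choose 0) / (2 * Real.pi) else 0

/-- The index of a closed curve on the surface about a point, taken in the oriented chart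
`fr.coord`. -/
def Frame.index (fr : Frame c) (L : ℝ) (γ : ℝ → Amb) (p : Amb) : ℝ :=
  planeIndex L (fun s => fr.coord (γ s)) (fr.coord p)

/-- The area with multiplicities enclosed by `γ`. -/
def Frame.areaWithMult (fr : Frame c) (L : ℝ) (γ : ℝ → Amb) : ℝ :=
  ∫ p, fr.index L γ p ∂fr.areaMeasure

/-- The improper integral of `f` over `[0, L]`, with `f` possibly unbounded or undefined near the
finitely many points of `S`, converges and equals `I`: there is a continuous function on
`[0, L]` that is a primitive of `f` away from `S` and increases by `I`. -/
def HasImproperIntegral (f : ℝ → ℝ) (L : ℝ) (S : Finset ℝ) (I : ℝ) : Prop :=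
  ∃ K : ℝ → ℝ, ContinuousOn K (Set.Icc 0 L) ∧
    (∀ s ∈ Set.Ioo 0 L, s ∉ S → HasDerivAt K (f s) s) ∧ K L - K 0 = I

end ConstCurv

end

/-!
In the stereographic coordinate `z = x + i y` the surface carries the conformal metric
`λ² |dz|²` with `λ = 1 / (1 + c |z|² / 4)` (`radialFactor`). For a unit-speed curve `z(s)` the
geodesic curvature is
`k_g = Im (z'' / z') - (c / 2) λ Im (z̄ z')` (`IsClosedPiecewiseC2.geodesicCurvature_chart`),
so its integral is the variation of the tangent angle along the smooth arcs, minus `c / 2` times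
the integral of `λ (x dy - y dx)`.

The second term is `c` times the area with multiplicities, by Green's formula for curves that need
not be simple (`IsClosedPlaneCurve.integral_planeIndex`). The index is the logarithmic integral
`(1 / 2π) ∫ Im (z' / (z - w)) ds` (`planeIndex_eq_integral`), the kernel is absolutely integrable
in `(s, w)`, and exchanging the integrals leaves the Cauchy transform of the radial density `λ²`,
which is `π λ(ζ) ζ̄` (`integral_area_density_mul_inv_sub`) by the mean value property. The index
vanishes off a disc containing the curve, so that only a compact part of the chart matters.

The first term is needed only modulo `2π`, since `ν` is an arbitrary integer. At a corner the
velocity turns by `π - θ` (`IsClosedPiecewiseC2.unit_tangent_jump`). Undoing these rotations one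
after the other makes the velocity in the chart a continuous nonvanishing function on `[0, L]`,
whose argument lifts to a continuous function `ψ` (`IsClosedPiecewiseC2.exists_tangent_angle`).
The velocities at `0` and `L` agree, so `ψ` increases by `- ∑ (π - θ_a)` up to a multiple of `2π`.
The primitive of `k_g` required by the improper integral is
`ψ - (c / 2) ∫ λ (x dy - y dx)`.
-/

namespace ConstCurv

/-! ### Continuous branches of the argument -/

/-- A continuous nonvanishing function on an interval has a continuous logarithm: `exp` is a
covering of the punctured plane. -/
theorem exists_continuous_log {V : ℝ → ℂ} {a b : ℝ} (hab : a ≤ b)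
    (hV : ContinuousOn V (Set.Icc a b)) (h0 : ∀ s ∈ Set.Icc a b, V s ≠ 0) :
    ∃ f : ℝ → ℂ, Continuous f ∧ ∀ s ∈ Set.Icc a b, Complex.exp (f s) = V s := by
  have hW : Continuous fun s => V (Set.projIcc a b hab s) :=
    (continuousOn_iff_continuous_domRestrict.mp hV).comp continuous_projIcc
  have hW0 : ∀ s, V (Set.projIcc a b hab s) ≠ 0 := fun s => h0 _ (Set.projIcc a b hab s).2
  obtain ⟨f, ⟨-, hf⟩, -⟩ := Complex.isCoveringMapOn_exp.existsUnique_continuousMap_lifts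
    (⟨_, hW⟩ : C(ℝ, ℂ)) (a₀ := 0) (Complex.exp_log (hW0 0)) hW0
  refine ⟨f, f.continuous, fun s hs => ?_⟩
  have := congrFun hf s
  simpa [Set.projIcc_of_mem hab hs] using this

theorem eq_norm_mul_exp_im {z w : ℂ} (h : Complex.exp w = z) :
    z = ‖z‖ * Complex.exp (w.im * Complex.I) := by
  rw [← h, Complex.norm_exp, Complex.ofReal_exp, ← Complex.exp_add, Complex.re_add_im]

/-- Every continuous branch of the argument of `g` has derivative `Im (g' / g)`: near `s` it differs
from the principal argument of `g t / g s` by a constant. -/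
theorem hasDerivAt_argument {g : ℝ → ℂ} {g' : ℂ} {ψ : ℝ → ℝ} {s : ℝ} (hg : HasDerivAt g g' s)
    (h0 : g s ≠ 0) (hψ : ContinuousAt ψ s)
    (h : ∀ᶠ t in 𝓝 s, g t = ‖g t‖ * Complex.exp (ψ t * Complex.I)) :
    HasDerivAt ψ (g' / g s).im s := by
  have hlog : HasDerivAt (fun t => ψ s + (Complex.log (g t / g s)).im) (g' / g s).im s := by
    have h1 : HasDerivAt (fun t => g t / g s) (g' / g s) s := hg.div_const _
    have h2 : HasDerivAt (fun t => Complex.log (g t / g s)) ((g' / g s) / (g s / g s)) s :=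
      h1.clog_real (by rw [div_self h0]; exact Complex.one_mem_slitPlane)
    rw [div_self h0, div_one] at h2
    have h3 := (Complex.imCLM.hasFDerivAt (x := Complex.log (g s / g s))).comp_hasDerivAt s h2
    exact h3.const_add (ψ s)
  refine hlog.congr_of_eventuallyEq ?_
  have hs := h.self_of_nhds
  have hclose : ∀ᶠ t in 𝓝 s, ψ t - ψ s ∈ Set.Ioo (-Real.pi) Real.pi := by
    have : Tendsto (fun t => ψ t - ψ s) (𝓝 s) (𝓝 0) := by
      have : Tendsto (fun t => ψ t - ψ s) (𝓝 s) (𝓝 (ψ s - ψ s)) :=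
        hψ.tendsto.sub tendsto_const_nhds
      rwa [sub_self] at this
    exact this (Ioo_mem_nhds (by linarith [Real.pi_pos]) Real.pi_pos)
  filter_upwards [h, hclose, hg.continuousAt.eventually_ne h0] with t ht hc hne
  have e : g t / g s = ((‖g t‖ / ‖g s‖ : ℝ) : ℂ) * Complex.exp ((ψ t - ψ s : ℝ) * Complex.I) := by
    conv_lhs => rw [ht, hs]
    rw [mul_div_mul_comm, ← Complex.exp_sub]
    push_cast
    ring_nf
  rw [Complex.log_im, e, Complex.arg_real_mul _ (by positivity), Complex.arg_exp_mul_I,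
    toIocMod_eq_self (Real.two_pi_pos) |>.2 ⟨hc.1, by linarith [hc.2]⟩]
  ring

/-- The index of a closed curve as a logarithmic integral. No regularity is needed at the
countably many parameters `T`. -/
theorem planeIndex_eq_integral {L : ℝ} (hL : 0 ≤ L) {z : ℝ → ℂ} {T : Set ℝ} (hT : T.Countable)
    (hz : Continuous z) (hd : ∀ s ∈ Set.Ioo 0 L \ T, DifferentiableAt ℝ z s) {w : ℂ}
    (hw : ∀ s ∈ Set.Icc 0 L, z s ≠ w)
    (hi : IntervalIntegrable (fun s => (deriv z s / (z s - w)).im) volume 0 L) :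
    planeIndex L z w = (∫ s in (0 : ℝ)..L, (deriv z s / (z s - w)).im) / (2 * Real.pi) := by
  have hex : ∃ ψ, IsArgBranch L z w ψ := by
    obtain ⟨f, hf, he⟩ := exists_continuous_log hL (V := fun s => z s - w) (by fun_prop)
      (fun s hs => sub_ne_zero.2 (hw s hs))
    exact ⟨fun s => (f s).im, (Complex.continuous_im.comp hf).continuousOn,
      fun s hs => ⟨hw s hs, eq_norm_mul_exp_im (he s hs)⟩⟩
  rw [planeIndex, dif_pos hex]
  obtain ⟨hc, hb⟩ := hex.choose_spec
  congr 1
  symm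
  refine integral_eq_of_hasDerivAt_off_countable_of_le _ _ hL hT hc (fun s hs => ?_) hi
  have hs' : Set.Icc 0 L ∈ 𝓝 s := Icc_mem_nhds hs.1.1 hs.1.2
  refine hasDerivAt_argument (g := fun s => z s - w) ((hd s hs).hasDerivAt.sub_const w)
    (sub_ne_zero.2 (hw s (Set.Ioo_subset_Icc_self hs.1))) (hc.continuousAt hs') ?_
  filter_upwards [hs'] with t ht using (hb t ht).2

/-- A closed curve in a disc has index `0` about the points outside: there `log (1 - z / w)` is a
single-valued primitive. -/
theorem planeIndex_eq_zero_of_norm_lt {L : ℝ} (hL : 0 ≤ L) {z : ℝ → ℂ} {T : Set ℝ}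
    (hT : T.Countable)
    (hz : Continuous z) (hd : ∀ s ∈ Set.Ioo 0 L \ T, DifferentiableAt ℝ z s)
    (hc : z L = z 0) {w : ℂ} (hw : ∀ s ∈ Set.Icc 0 L, ‖z s‖ < ‖w‖)
    (hi : IntervalIntegrable (deriv z) volume 0 L) :
    planeIndex L z w = 0 := by
  have hne : ∀ s ∈ Set.Icc 0 L, z s ≠ w := fun s hs h => (hw s hs).ne (by rw [h])
  have hw0 : w ≠ 0 := by
    have := (norm_nonneg (z 0)).trans_lt (hw 0 ⟨le_rfl, hL⟩)
    exact norm_pos_iff.1 this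
  have hi' : IntervalIntegrable (fun s => deriv z s / (z s - w)) volume 0 L := by
    simp only [div_eq_mul_inv]
    refine hi.mul_continuousOn (ContinuousOn.inv₀ (by fun_prop) ?_)
    rw [Set.uIcc_of_le hL]
    exact fun s hs => sub_ne_zero.2 (hne s hs)
  have him : ∫ s in (0 : ℝ)..L, (deriv z s / (z s - w)).im
      = (∫ s in (0 : ℝ)..L, deriv z s / (z s - w)).im :=
    (Complex.imCLM.intervalIntegral_comp_comm hi')
  have hslit : ∀ s ∈ Set.Icc 0 L, 1 - z s / w ∈ Complex.slitPlane := by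
    intro s hs
    left
    have h1 : (z s / w).re ≤ ‖z s / w‖ := Complex.re_le_norm _
    have h2 : ‖z s / w‖ < 1 := by
      rw [norm_div, div_lt_one (norm_pos_iff.2 hw0)]; exact hw s hs
    simp only [Complex.sub_re, Complex.one_re]
    linarith
  have hint : ∫ s in (0 : ℝ)..L, deriv z s / (z s - w)
      = Complex.log (1 - z L / w) - Complex.log (1 - z 0 / w) := by
    refine integral_eq_of_hasDerivAt_off_countable_of_le (fun s => Complex.log (1 - z s / w)) _
      hL hT ?_ (fun s hs => ?_) hi'
    · exact ContinuousOn.clog (by fun_prop) hslit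
    · have hs' := Set.Ioo_subset_Icc_self hs.1
      have h1 := (((hd s hs).hasDerivAt.div_const w).const_sub 1).clog_real (hslit s hs')
      refine h1.congr_deriv ?_
      have h3 : 1 - z s / w = -(z s - w) / w := by field_simp; ring
      rw [h3, ← neg_div, div_div_div_cancel_right₀ hw0, neg_div_neg_eq]
  rw [planeIndex_eq_integral hL hT hz hd hne (by exact ⟨hi'.1.im, hi'.2.im⟩), him, hint, hc]
  simp

/-! ### The Cauchy transform of a radial density -/

/-- In the plane the Jacobian `r` of polar coordinates cancels the singularity of `1 / r`. -/
theorem integrableOn_norm_inv_ball (r : ℝ) :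
    IntegrableOn (fun w : ℂ => ‖w‖⁻¹) (Metric.ball 0 r) := by
  refine (integrableOn_fun_norm_addHaar volume (f := fun y : ℝ => y⁻¹)).2 ?_
  have h1 : IntegrableOn (fun _ : ℝ => (1 : ℝ)) (Set.Ioo 0 r) :=
    integrableOn_const (by simp)
  refine h1.congr_fun (fun y hy => ?_) measurableSet_Ioo
  have : y ≠ 0 := hy.1.ne'
  simp [Complex.finrank_real_complex, this]

/-- Integrability is preserved by passing to polar coordinates. -/
theorem integrable_polarCoord {f : ℂ → ℂ} (hf : Measurable f) (hi : Integrable f) :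
    IntegrableOn (fun p : ℝ × ℝ => p.1 • f (Complex.polarCoord.symm p)) polarCoord.target := by
  have hm : Measurable (Complex.polarCoord.symm : ℝ × ℝ → ℂ) := by
    have : (Complex.polarCoord.symm : ℝ × ℝ → ℂ)
        = fun p => p.1 * (Real.cos p.2 + Real.sin p.2 * Complex.I) := by
      funext p; exact Complex.polarCoord_symm_apply p
    rw [this]; fun_prop
  refine ⟨(measurable_fst.smul (hf.comp hm)).aestronglyMeasurable, ?_⟩
  have h := hi.2
  unfold HasFiniteIntegral at h ⊢
  rw [← Complex.lintegral_comp_polarCoord_symm] at h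
  refine lt_of_eq_of_lt (setLIntegral_congr_fun polarCoord.open_target.measurableSet
    fun p hp => ?_) h
  have hp1 : 0 < p.1 := by
    have : p ∈ Set.Ioi (0 : ℝ) ×ˢ Set.Ioo (-Real.pi) Real.pi := hp
    exact this.1
  simp only [enorm_smul, smul_eq_mul]
  rw [Real.enorm_eq_ofReal hp1.le]

theorem integral_circle_eq_circleAverage (g : ℂ → ℂ) (r : ℝ) :
    ∫ θ in Set.Ioo (-Real.pi) Real.pi, g (Complex.polarCoord.symm (r, θ))
      = (2 * Real.pi : ℝ) • Real.circleAverage g 0 r := by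
  have hper : Function.Periodic (fun θ => g (circleMap 0 r θ)) (2 * Real.pi) :=
    fun θ => by simp [periodic_circleMap 0 r θ]
  have h1 := hper.intervalIntegral_add_eq (-Real.pi) 0
  rw [Real.circleAverage_def, smul_smul, mul_inv_cancel₀ Real.two_pi_pos.ne', one_smul]
  rw [zero_add, show -Real.pi + 2 * Real.pi = Real.pi by ring] at h1
  rw [← h1, intervalIntegral.integral_of_le (by linarith [Real.pi_pos]),
    integral_Ioc_eq_integral_Ioo]
  refine integral_congr_ae (ae_of_all _ fun θ => ?_)
  simp [Complex.polarCoord_symm_apply, circleMap, Complex.exp_mul_I]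

/-- Mean value property for `w ↦ 1 / (ζ - w)`, which is holomorphic on the disc. -/
theorem circleAverage_inv_sub_of_lt {ζ : ℂ} {r : ℝ} (hr : 0 ≤ r) (h : r < ‖ζ‖) :
    Real.circleAverage (fun w => (ζ - w)⁻¹) 0 r = ζ⁻¹ := by
  have hne : ∀ w ∈ Metric.closedBall (0 : ℂ) |r|, ζ - w ≠ 0 := by
    intro w hw h0
    rw [mem_closedBall_zero_iff, abs_of_nonneg hr, ← sub_eq_zero.1 h0] at hw
    linarith
  have := circleAverage_of_differentiable_on_off_countable (f := fun w : ℂ => (ζ - w)⁻¹)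
    (c := 0) (R := r) Set.countable_empty
    (ContinuousOn.inv₀ (by fun_prop) hne)
    (fun w hw => DifferentiableAt.inv (by fun_prop)
      (hne w (Metric.ball_subset_closedBall hw.1)))
  simpa using this

/-- On a circle enclosing `ζ`, inversion turns `1 / (ζ - w)` into the boundary values of a
holomorphic function vanishing at the centre. -/
theorem circleAverage_inv_sub_of_gt {ζ : ℂ} {r : ℝ} (h : ‖ζ‖ < r) :
    Real.circleAverage (fun w => (ζ - w)⁻¹) 0 r = 0 := by
  have hr : 0 < r := (norm_nonneg _).trans_lt h
  have e1 : Real.circleAverage (fun w => (ζ - w)⁻¹) 0 r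
      = Real.circleAverage (fun u => (ζ - r * u)⁻¹) 0 1 := by
    simp [Real.circleAverage_def, circleMap]
  rw [e1, ← Real.circleAverage_zero_one_congr_inv]
  have hne : ∀ u ∈ Metric.closedBall (0 : ℂ) |1|, ζ * u - r ≠ 0 := by
    intro u hu h0
    rw [mem_closedBall_zero_iff, abs_one] at hu
    have h1 : ‖ζ * u‖ = r := by
      rw [sub_eq_zero.1 h0, Complex.norm_real, Real.norm_of_nonneg hr.le]
    rw [norm_mul] at h1
    nlinarith [norm_nonneg ζ]
  have e2 : Real.circleAverage (fun u : ℂ => (ζ - r * u⁻¹)⁻¹) 0 1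
      = Real.circleAverage (fun u => u * (ζ * u - r)⁻¹) 0 1 := by
    refine Real.circleAverage_congr_sphere fun u hu => ?_
    have hu0 : u ≠ 0 := by
      rintro rfl
      simp at hu
    have := hne u (by simpa using (Metric.sphere_subset_closedBall hu))
    have h1 : ζ - r * u⁻¹ = (ζ * u - r) * u⁻¹ := by field_simp
    rw [h1, mul_inv, inv_inv, mul_comm]
  rw [e2]
  have := circleAverage_of_differentiable_on_off_countable
    (f := fun u : ℂ => u * (ζ * u - r)⁻¹)
    (c := 0) (R := 1) Set.countable_empty
    (ContinuousOn.mul continuousOn_id (ContinuousOn.inv₀ (by fun_prop) hne))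
    (fun w hw => DifferentiableAt.mul differentiableAt_id (DifferentiableAt.inv (by fun_prop)
      (hne w (Metric.ball_subset_closedBall hw.1))))
  simpa using this

theorem integrableOn_inv_sub_ball (ζ : ℂ) (R : ℝ) :
    IntegrableOn (fun w : ℂ => (ζ - w)⁻¹) (Metric.ball 0 R) := by
  have h := (integrableOn_norm_inv_ball (R + ‖ζ‖)).integrable_indicator measurableSet_ball
  have h2 := (h.comp_sub_left ζ).integrableOn (s := Metric.ball 0 R)
  refine h2.mono' (by fun_prop) ?_
  refine (ae_restrict_mem measurableSet_ball).mono fun w hw => ?_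
  rw [Set.indicator_of_mem]
  · simp
  · rw [mem_ball_zero_iff] at hw ⊢
    linarith [norm_sub_le ζ w]

/-- A radially distributed mass acts at `ζ` as if the part inside the circle through `ζ` were
concentrated at the origin and the part outside were absent. -/
theorem integral_radial_mul_inv_sub {ρ : ℝ → ℝ} (hρ : Measurable ρ) {R C : ℝ}
    (hb : ∀ r ∈ Set.Ico 0 R, |ρ r| ≤ C) {ζ : ℂ} (hζ : ‖ζ‖ ≤ R) :
    ∫ w in Metric.ball (0 : ℂ) R, (ρ ‖w‖ : ℂ) * (ζ - w)⁻¹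
      = 2 * Real.pi * ζ⁻¹ * ((∫ r in (0 : ℝ)..‖ζ‖, r * ρ r : ℝ) : ℂ) := by
  set f : ℂ → ℂ := (Metric.ball (0 : ℂ) R).indicator fun w => (ρ ‖w‖ : ℂ) * (ζ - w)⁻¹ with hf
  have hfm : Measurable f := by
    refine Measurable.indicator ?_ measurableSet_ball
    fun_prop
  have hfi : Integrable f := by
    rw [hf, integrable_indicator_iff measurableSet_ball]
    refine (integrableOn_inv_sub_ball ζ R).bdd_mul (c := C)
      (Complex.measurable_ofReal.comp (hρ.comp measurable_norm)).aestronglyMeasurable ?_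
    refine (ae_restrict_mem measurableSet_ball).mono fun w hw => ?_
    rw [Complex.norm_real]
    exact hb _ ⟨norm_nonneg _, by simpa using hw⟩
  rw [← integral_indicator measurableSet_ball, ← hf, ← Complex.integral_comp_polarCoord_symm]
  have hp := integrable_polarCoord hfm hfi
  have htar : polarCoord.target = Set.Ioi (0 : ℝ) ×ˢ Set.Ioo (-Real.pi) Real.pi := rfl
  rw [htar] at hp ⊢
  rw [Measure.volume_eq_prod] at hp ⊢
  rw [setIntegral_prod _ hp]
  have inner : ∀ r ∈ Set.Ioi (0 : ℝ), r ≠ ‖ζ‖ →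
      ∫ θ in Set.Ioo (-Real.pi) Real.pi, r • f (Complex.polarCoord.symm (r, θ))
        = (Set.Ioc 0 ‖ζ‖).indicator (fun r => 2 * Real.pi * ζ⁻¹ * ((r * ρ r : ℝ) : ℂ)) r := by
    intro r (hr : 0 < r) hrζ
    have hn : ∀ θ, ‖Complex.polarCoord.symm (r, θ)‖ = r := fun θ => by
      rw [Complex.norm_polarCoord_symm, abs_of_pos hr]
    rcases hrζ.lt_or_gt with h | h
    · have hfe : ∀ θ, r • f (Complex.polarCoord.symm (r, θ))
          = ((r * ρ r : ℝ) : ℂ) * (ζ - Complex.polarCoord.symm (r, θ))⁻¹ := by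
        intro θ
        rw [hf, Set.indicator_of_mem (by rw [mem_ball_zero_iff, hn]; linarith), hn]
        rw [Complex.real_smul]; push_cast; ring
      simp only [hfe]
      rw [integral_const_mul, integral_circle_eq_circleAverage (fun w => (ζ - w)⁻¹),
        circleAverage_inv_sub_of_lt hr.le h,
        Set.indicator_of_mem (show r ∈ Set.Ioc 0 ‖ζ‖ from ⟨hr, h.le⟩), Complex.real_smul]
      push_cast; ring
    · rw [Set.indicator_of_notMem (fun hh => not_lt.2 hh.2 h)]
      by_cases hrR : r < R
      · have hfe : ∀ θ, r • f (Complex.polarCoord.symm (r, θ))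
            = ((r * ρ r : ℝ) : ℂ) * (ζ - Complex.polarCoord.symm (r, θ))⁻¹ := by
          intro θ
          rw [hf, Set.indicator_of_mem (by rw [mem_ball_zero_iff, hn]; linarith), hn]
          rw [Complex.real_smul]; push_cast; ring
        simp only [hfe]
        rw [integral_const_mul, integral_circle_eq_circleAverage (fun w => (ζ - w)⁻¹),
          circleAverage_inv_sub_of_gt h]
        simp
      · have hfe : ∀ θ, r • f (Complex.polarCoord.symm (r, θ)) = 0 := by
          intro θ
          rw [hf, Set.indicator_of_notMem (by rw [mem_ball_zero_iff, hn]; exact hrR), smul_zero]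
        simp only [hfe, integral_zero]
  have hae : ∀ᵐ r ∂(volume.restrict (Set.Ioi (0 : ℝ))),
      ∫ θ in Set.Ioo (-Real.pi) Real.pi, r • f (Complex.polarCoord.symm (r, θ))
        = (Set.Ioc 0 ‖ζ‖).indicator (fun r => 2 * Real.pi * ζ⁻¹ * ((r * ρ r : ℝ) : ℂ)) r := by
    filter_upwards [ae_restrict_mem measurableSet_Ioi,
      ae_restrict_of_ae (Measure.ae_ne volume ‖ζ‖)] with r h1 h2 using inner r h1 h2
  rw [integral_congr_ae hae, integral_indicator measurableSet_Ioc,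
    Measure.restrict_restrict measurableSet_Ioc,
    Set.inter_eq_left.2 (fun x hx => hx.1), integral_const_mul,
    intervalIntegral.integral_of_le (norm_nonneg _)]
  congr 1
  exact integral_ofReal

/-- The conformal factor of the stereographic parametrization, as a function of the radius. -/
noncomputable def radialFactor (c r : ℝ) : ℝ := (1 + c / 4 * r ^ 2)⁻¹

theorem one_add_pos_of_le {c R r : ℝ} (hR : 0 < 1 + c / 4 * R ^ 2) (h0 : 0 ≤ r) (h : r ≤ R) :
    0 < 1 + c / 4 * r ^ 2 := by
  rcases le_total 0 c with hc | hc
  · positivity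
  · have : r ^ 2 ≤ R ^ 2 := by gcongr
    nlinarith

theorem integral_mul_radialFactor_sq {c r : ℝ} (hr : 0 ≤ r) (h : 0 < 1 + c / 4 * r ^ 2) :
    ∫ t in (0 : ℝ)..r, t * radialFactor c t ^ 2 = radialFactor c r * r ^ 2 / 2 := by
  have hpos : ∀ t ∈ Set.uIcc 0 r, 1 + c / 4 * t ^ 2 ≠ 0 := by
    intro t ht
    rw [Set.uIcc_of_le hr] at ht
    exact (one_add_pos_of_le h ht.1 ht.2).ne'
  have := intervalIntegral.integral_eq_sub_of_hasDerivAt (a := 0) (b := r)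
    (f := fun t => radialFactor c t * t ^ 2 / 2) (f' := fun t => t * radialFactor c t ^ 2)
    (fun t ht => ?_) ?_
  · rw [this]; simp
  · have h0 := hpos t ht
    have h1 : HasDerivAt (fun t : ℝ => t ^ 2) (2 * t) t := by simpa using hasDerivAt_pow 2 t
    have h2 := (((h1.const_mul (c / 4)).const_add 1).inv h0).mul h1 |>.div_const 2
    refine h2.congr_deriv ?_
    simp only [radialFactor, Pi.inv_apply]
    field_simp
    ring
  · refine ContinuousOn.intervalIntegrable ?_
    unfold radialFactor
    exact continuousOn_id.mul ((ContinuousOn.inv₀ (by fun_prop) hpos).pow 2)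

theorem radialFactor_sq_le {c R r : ℝ} (hR : 0 < 1 + c / 4 * R ^ 2) (h0 : 0 ≤ r) (h : r ≤ R) :
    radialFactor c r ^ 2 ≤ 1 + radialFactor c R ^ 2 := by
  unfold radialFactor
  have hr := one_add_pos_of_le hR h0 h
  rcases le_total 0 c with hc | hc
  · have : (1 + c / 4 * r ^ 2)⁻¹ ≤ 1 := inv_le_one_of_one_le₀ (by
      have : 0 ≤ c / 4 * r ^ 2 := by positivity
      linarith)
    nlinarith [inv_pos.2 hr, sq_nonneg (1 + c / 4 * R ^ 2)⁻¹]
  · have h3 : (1 + c / 4 * r ^ 2)⁻¹ ≤ (1 + c / 4 * R ^ 2)⁻¹ := by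
      apply inv_anti₀ hR
      have : r ^ 2 ≤ R ^ 2 := by gcongr
      nlinarith
    nlinarith [inv_pos.2 hr]

/-- The Cauchy transform of the area density of the surface. -/
theorem integral_area_density_mul_inv_sub {c R : ℝ} (hR : 0 < 1 + c / 4 * R ^ 2) {ζ : ℂ}
    (hζ : ‖ζ‖ ≤ R) :
    ∫ w in Metric.ball (0 : ℂ) R, ((radialFactor c ‖w‖ ^ 2 : ℝ) : ℂ) * (ζ - w)⁻¹
      = Real.pi * radialFactor c ‖ζ‖ * (starRingEnd ℂ) ζ := by
  have hm : Measurable fun r => radialFactor c r ^ 2 := by unfold radialFactor; fun_prop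
  rw [integral_radial_mul_inv_sub (ρ := fun r => radialFactor c r ^ 2) hm
    (C := 1 + radialFactor c R ^ 2) (fun r hr => ?_) hζ,
    integral_mul_radialFactor_sq (norm_nonneg _) (one_add_pos_of_le hR (norm_nonneg _) hζ)]
  · by_cases h0 : ζ = 0
    · simp [h0]
    · have : ((‖ζ‖ : ℝ) : ℂ) ^ 2 = ζ * (starRingEnd ℂ) ζ := by
        rw [Complex.mul_conj, Complex.normSq_eq_norm_sq]; push_cast; rfl
      push_cast
      rw [this]
      field_simp
  · rw [abs_of_nonneg (sq_nonneg _)]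
    exact radialFactor_sq_le hR hr.1 hr.2.le

/-! ### Green's formula with multiplicities -/

/-- A curve is the image of a subset of the real axis under a map of the plane to itself,
differentiable at all but countably many points of that subset. -/
theorem volume_curve_eq_zero {z : ℝ → ℂ} {A T : Set ℝ} (hT : T.Countable)
    (hd : ∀ s ∈ A \ T, DifferentiableAt ℝ z s) : volume (z '' A) = 0 := by
  have hsub : z '' A ⊆ (fun w : ℂ => z w.re) '' {w : ℂ | w.im = 0 ∧ w.re ∈ A \ T} ∪ z '' T := by
    rintro _ ⟨s, hs, rfl⟩
    by_cases hsT : s ∈ T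
    · exact Or.inr ⟨s, hsT, rfl⟩
    · exact Or.inl ⟨s, ⟨by simp, by simpa using ⟨hs, hsT⟩⟩, by simp⟩
  refine measure_mono_null hsub (measure_union_null ?_ ((hT.image z).measure_zero _))
  refine addHaar_image_eq_zero_of_differentiableOn_of_addHaar_eq_zero volume ?_ ?_
  · intro w hw
    exact ((hd w.re hw.2).comp w Complex.reCLM.differentiableAt).differentiableWithinAt
  · refine measure_mono_null (fun w hw => ?_)
      (Measure.addHaar_submodule volume (LinearMap.ker Complex.imLm) fun h => ?_)
    · simpa using hw.1
    · have : Complex.I ∈ LinearMap.ker Complex.imLm := by rw [h]; trivial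
      simp at this

theorem ball_subset_chartDomain {c R : ℝ} (hR : 0 < 1 + c / 4 * R ^ 2) :
    Metric.ball 0 R ⊆ chartDomain c := fun w hw =>
  one_add_pos_of_le hR (norm_nonneg w) (by simpa using (mem_ball_zero_iff.1 hw).le)

theorem measurableSet_chartDomain {c : ℝ} : MeasurableSet (chartDomain c) :=
  measurableSet_lt measurable_const (by fun_prop)

/-- A closed plane curve, differentiable with bounded derivative outside a countable set of
parameters, that stays in the disc of radius `R`. -/
structure IsClosedPlaneCurve (L R M : ℝ) (T : Set ℝ) (z : ℝ → ℂ) : Prop where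
  length_pos : 0 < L
  countable : T.Countable
  continuous : Continuous z
  differentiableAt : ∀ s ∈ Set.Ioo 0 L \ T, DifferentiableAt ℝ z s
  deriv_le : ∀ s ∈ Set.Icc 0 L, ‖deriv z s‖ ≤ M
  closed : z L = z 0
  norm_lt : ∀ s ∈ Set.Icc 0 L, ‖z s‖ < R

section PlaneCurve

variable {L R M c : ℝ} {T : Set ℝ} {z : ℝ → ℂ}

namespace IsClosedPlaneCurve

theorem intervalIntegrable_deriv (h : IsClosedPlaneCurve L R M T z) :
    IntervalIntegrable (deriv z) volume 0 L := by
  rw [intervalIntegrable_iff_integrableOn_Ioc_of_le h.length_pos.le]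
  refine Measure.integrableOn_of_bounded (M := M) (by simp)
    (measurable_deriv z).aestronglyMeasurable ?_
  exact (ae_restrict_mem measurableSet_Ioc).mono fun s hs =>
    h.deriv_le s (Set.Ioc_subset_Icc_self hs)

theorem planeIndex_eq (h : IsClosedPlaneCurve L R M T z) {w : ℂ} (hw : w ∉ z '' Set.Icc 0 L) :
    planeIndex L z w = (∫ s in (0 : ℝ)..L, (deriv z s / (z s - w)).im) / (2 * Real.pi) := by
  have hne : ∀ s ∈ Set.Icc 0 L, z s ≠ w := fun s hs e => hw ⟨s, hs, e⟩
  refine planeIndex_eq_integral h.length_pos.le h.countable h.continuous h.differentiableAt hne ?_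
  have hi' : IntervalIntegrable (fun s => deriv z s / (z s - w)) volume 0 L := by
    simp only [div_eq_mul_inv]
    refine h.intervalIntegrable_deriv.mul_continuousOn
      (ContinuousOn.inv₀ (h.continuous.sub continuous_const).continuousOn ?_)
    rw [Set.uIcc_of_le h.length_pos.le]
    exact fun s hs => sub_ne_zero.2 (hne s hs)
  exact ⟨hi'.1.im, hi'.2.im⟩

/-- The kernel of the double integral expressing the area with multiplicities is absolutely
integrable: `1 / ‖u‖` is integrable on discs of the plane. -/
theorem integrable_kernel (h : IsClosedPlaneCurve L R M T z) (hR : 0 < 1 + c / 4 * R ^ 2) :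
    Integrable (fun p : ℝ × ℂ => radialFactor c ‖p.2‖ ^ 2 * (deriv z p.1 / (z p.1 - p.2)).im)
      ((volume.restrict (Set.Ioc 0 L)).prod (volume.restrict (Metric.ball 0 R))) := by
  set k : ℂ → ℝ := (Metric.ball (0 : ℂ) (2 * R)).indicator fun u => ‖u‖⁻¹ with hk
  have hkm : Measurable k := Measurable.indicator (by fun_prop) measurableSet_ball
  have hki : Integrable k := (integrableOn_norm_inv_ball (2 * R)).integrable_indicator
    measurableSet_ball
  have hzm : Measurable z := h.continuous.measurable
  have hdm := measurable_deriv z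
  have hmain : Integrable (fun p : ℝ × ℂ => k (z p.1 - p.2))
      ((volume.restrict (Set.Ioc 0 L)).prod volume) := by
    rw [integrable_prod_iff]
    · refine ⟨ae_of_all _ fun s => hki.comp_sub_left (z s), ?_⟩
      have : ∀ s : ℝ, ∫ y, ‖k (z s - y)‖ = ∫ u, ‖k u‖ := fun s =>
        integral_sub_left_eq_self (fun u => ‖k u‖) volume (z s)
      simp only [this]
      exact integrable_const _
    · exact (hkm.comp ((hzm.comp measurable_fst).sub measurable_snd)).aestronglyMeasurable
  have hmain' : Integrable (fun p : ℝ × ℂ => (1 + radialFactor c R ^ 2) * M * k (z p.1 - p.2))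
      ((volume.restrict (Set.Ioc 0 L)).prod (volume.restrict (Metric.ball 0 R))) := by
    refine Integrable.const_mul (hmain.mono_measure ?_) _
    exact Measure.prod_mono le_rfl Measure.restrict_le_self
  refine hmain'.mono' ?_ ?_
  · have h1 : Measurable fun p : ℝ × ℂ => radialFactor c ‖p.2‖ ^ 2 := by
      unfold radialFactor; fun_prop
    have h2 : Measurable fun p : ℝ × ℂ => (deriv z p.1 / (z p.1 - p.2)).im :=
      Complex.measurable_im.comp
        ((hdm.comp measurable_fst).div ((hzm.comp measurable_fst).sub measurable_snd))
    exact (h1.mul h2).aestronglyMeasurable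
  · rw [Measure.prod_restrict]
    refine (ae_restrict_mem (measurableSet_Ioc.prod measurableSet_ball)).mono ?_
    rintro ⟨s, w⟩ ⟨hs, hw⟩
    have hs' := Set.Ioc_subset_Icc_self hs
    have hw' : ‖w‖ < R := by simpa using hw
    have hmem : z s - w ∈ Metric.ball (0 : ℂ) (2 * R) := by
      rw [mem_ball_zero_iff]
      linarith [norm_sub_le (z s) w, h.norm_lt s hs']
    simp only
    rw [hk, Set.indicator_of_mem hmem, norm_mul, Real.norm_of_nonneg (sq_nonneg _), mul_assoc]
    refine mul_le_mul (radialFactor_sq_le hR (norm_nonneg _) hw'.le) ?_ (norm_nonneg _)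
      (by positivity)
    refine (Complex.abs_im_le_norm _).trans ?_
    rw [norm_div, div_eq_mul_inv]
    exact mul_le_mul_of_nonneg_right (h.deriv_le s hs') (by positivity)

theorem ae_planeIndex_eq (h : IsClosedPlaneCurve L R M T z) :
    ∀ᵐ w ∂(volume.restrict (Metric.ball (0 : ℂ) R)),
      radialFactor c ‖w‖ ^ 2 * planeIndex L z w = (2 * Real.pi)⁻¹ *
        ∫ s in Set.Ioc 0 L, radialFactor c ‖w‖ ^ 2 * (deriv z s / (z s - w)).im := by
  have hnull : volume (z '' Set.Icc 0 L) = 0 := by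
    refine volume_curve_eq_zero (T := T ∪ {0, L})
      (h.countable.union (Set.toFinite _).countable) fun s hs => ?_
    simp only [Set.mem_sdiff, Set.mem_Icc, Set.mem_union, Set.mem_insert_iff,
      Set.mem_singleton_iff, not_or] at hs
    exact h.differentiableAt s
      ⟨⟨lt_of_le_of_ne hs.1.1 (Ne.symm hs.2.2.1), lt_of_le_of_ne hs.1.2 hs.2.2.2⟩, hs.2.1⟩
  refine ae_restrict_of_ae ?_
  filter_upwards [measure_eq_zero_iff_ae_notMem.1 hnull] with w hw
  rw [h.planeIndex_eq hw, integral_const_mul, intervalIntegral.integral_of_le h.length_pos.le]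
  ring

theorem planeIndex_eq_zero (h : IsClosedPlaneCurve L R M T z) {w : ℂ}
    (hw : w ∉ Metric.ball (0 : ℂ) R) : planeIndex L z w = 0 :=
  planeIndex_eq_zero_of_norm_lt h.length_pos.le h.countable h.continuous h.differentiableAt
    h.closed (fun s hs => (h.norm_lt s hs).trans_le (by simpa using hw))
    h.intervalIntegrable_deriv

theorem integrableOn_planeIndex (h : IsClosedPlaneCurve L R M T z)
    (hR : 0 < 1 + c / 4 * R ^ 2) :
    IntegrableOn (fun w => radialFactor c ‖w‖ ^ 2 * planeIndex L z w) (chartDomain c) := by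
  have h1 : IntegrableOn (fun w => radialFactor c ‖w‖ ^ 2 * planeIndex L z w)
      (Metric.ball 0 R) :=
    ((h.integrable_kernel hR).integral_prod_right.const_mul (2 * Real.pi)⁻¹).congr
      (h.ae_planeIndex_eq.mono fun w hw => hw.symm)
  refine h1.of_forall_sdiff_eq_zero measurableSet_chartDomain fun w hw => ?_
  rw [h.planeIndex_eq_zero hw.2, mul_zero]

/-- **Green's formula with multiplicities** for the area density of a metric of constant
curvature in a stereographic coordinate. -/
theorem integral_planeIndex (h : IsClosedPlaneCurve L R M T z) (hR : 0 < 1 + c / 4 * R ^ 2) :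
    ∫ w in chartDomain c, radialFactor c ‖w‖ ^ 2 * planeIndex L z w
      = (∫ s in (0 : ℝ)..L,
          radialFactor c ‖z s‖ * ((starRingEnd ℂ) (z s) * deriv z s).im) / 2 := by
  rw [setIntegral_eq_of_subset_of_forall_sdiff_eq_zero measurableSet_chartDomain
    (ball_subset_chartDomain hR) (fun w hw => by rw [h.planeIndex_eq_zero hw.2, mul_zero]),
    integral_congr_ae h.ae_planeIndex_eq, integral_const_mul,
    ← integral_integral_swap (h.integrable_kernel hR),
    intervalIntegral.integral_of_le h.length_pos.le, eq_div_iff two_ne_zero, mul_comm, ← mul_assoc,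
    ← integral_const_mul]
  refine setIntegral_congr_fun measurableSet_Ioc fun s hs => ?_
  have hs' := Set.Ioc_subset_Icc_self hs
  have hint : IntegrableOn
      (fun w : ℂ => deriv z s * (((radialFactor c ‖w‖ ^ 2 : ℝ) : ℂ) * (z s - w)⁻¹))
      (Metric.ball 0 R) := by
    refine Integrable.const_mul ?_ _
    refine (integrableOn_inv_sub_ball (z s) R).bdd_mul (c := 1 + radialFactor c R ^ 2) ?_ ?_
    · have : Measurable fun w : ℂ => radialFactor c ‖w‖ ^ 2 := by unfold radialFactor; fun_prop
      exact (Complex.measurable_ofReal.comp this).aestronglyMeasurable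
    · refine (ae_restrict_mem measurableSet_ball).mono fun w hw => ?_
      rw [Complex.norm_real, Real.norm_of_nonneg (sq_nonneg _)]
      exact radialFactor_sq_le hR (norm_nonneg _) (by simpa using (mem_ball_zero_iff.1 hw).le)
  have him : ∫ w in Metric.ball (0 : ℂ) R,
        radialFactor c ‖w‖ ^ 2 * (deriv z s / (z s - w)).im
      = (∫ w in Metric.ball (0 : ℂ) R,
          deriv z s * (((radialFactor c ‖w‖ ^ 2 : ℝ) : ℂ) * (z s - w)⁻¹)).im := by
    refine Eq.trans ?_ (Complex.imCLM.integral_comp_comm hint)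
    congr 1
    funext w
    rw [Complex.imCLM_apply, mul_left_comm, Complex.im_ofReal_mul, div_eq_mul_inv]
  rw [him, integral_const_mul, integral_area_density_mul_inv_sub hR (h.norm_lt s hs').le]
  have : deriv z s * (Real.pi * radialFactor c ‖z s‖ * (starRingEnd ℂ) (z s))
      = ((Real.pi * radialFactor c ‖z s‖ : ℝ) : ℂ) * ((starRingEnd ℂ) (z s) * deriv z s) := by
    push_cast; ring
  rw [this, Complex.im_ofReal_mul]
  field_simp

end IsClosedPlaneCurve

end PlaneCurve

/-! ### The stereographic chart -/

variable {c : ℝ}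

theorem form_comm (u v : Amb) : form c u v = form c v u := by
  simp only [form]; ring

theorem form_combo (p e f : Amb) (a x y a' x' y' : ℝ) :
    form c (a • p + x • e + y • f) (a' • p + x' • e + y' • f)
      = a * a' * form c p p + x * x' * form c e e + y * y' * form c f f
        + (a * x' + x * a') * form c e p + (a * y' + y * a') * form c f p
        + (x * y' + y * x') * form c e f := by
  simp only [form, Pi.add_apply, Pi.smul_apply, smul_eq_mul]; ring

/-- The determinant of three combinations of `e`, `f`, `p`; the scaling factor `r` of the last
vector is kept apart because it is absorbed by the unit normal. -/
theorem det_combo (p e f : Amb) (a₁ x₁ y₁ a₂ x₂ y₂ a₃ x₃ y₃ r : ℝ) :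
    Matrix.det (Matrix.of ![a₁ • p + x₁ • e + y₁ • f, a₂ • p + x₂ • e + y₂ • f,
        r • (a₃ • p + x₃ • e + y₃ • f)])
      = (a₃ * (x₁ * y₂ - y₁ * x₂) + x₃ * (y₁ * a₂ - a₁ * y₂) + y₃ * (a₁ * x₂ - x₁ * a₂))
        * Matrix.det (Matrix.of ![e, f, r • p]) := by
  simp [Matrix.det_fin_three]
  ring

theorem abs_eq_sign_mul (c : ℝ) : |c| = Real.sign c * c := by
  rcases lt_trichotomy c 0 with h | h | h
  · rw [Real.sign_of_neg h, abs_of_neg h]; ring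
  · simp [h]
  · rw [Real.sign_of_pos h, abs_of_pos h]; ring

namespace Frame

variable (fr : Frame c)

theorem form_pt_pt (hc : c ≠ 0) : form c fr.pt fr.pt = 1 / c := by
  have := fr.pt_mem
  simp only [surface, if_neg hc, Set.mem_ofPred_eq] at this
  exact this.1

theorem form_e₁_pt (hc : c ≠ 0) : form c fr.e₁ fr.pt = 0 := by
  have := fr.e₁_mem
  simpa only [tangentPlane, if_neg hc, Set.mem_ofPred_eq] using this

theorem form_e₂_pt (hc : c ≠ 0) : form c fr.e₂ fr.pt = 0 := by
  have := fr.e₂_mem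
  simpa only [tangentPlane, if_neg hc, Set.mem_ofPred_eq] using this

theorem form_combo_of_ne (hc : c ≠ 0) (a x y a' x' y' : ℝ) :
    form c (a • fr.pt + x • fr.e₁ + y • fr.e₂) (a' • fr.pt + x' • fr.e₁ + y' • fr.e₂)
      = a * a' / c + x * x' + y * y' := by
  rw [form_combo, fr.form_pt_pt hc, fr.form_e₁_pt hc, fr.form_e₂_pt hc, fr.e₁_unit, fr.e₂_unit,
    fr.orthogonal]
  ring

/-- A positively oriented orthonormal frame spans the unit area: its Gram matrix, the unit normal
included, is `diag(1, 1, sign c)`. -/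
theorem areaForm_frame : areaForm c fr.pt fr.e₁ fr.e₂ = 1 := by
  have hsq : areaForm c fr.pt fr.e₁ fr.e₂ ^ 2 = 1 := by
    by_cases hc : c = 0
    · subst hc
      have h1 : fr.e₁ 2 = 0 := by simpa [tangentPlane] using fr.e₁_mem
      have h2 : fr.e₂ 2 = 0 := by simpa [tangentPlane] using fr.e₂_mem
      have a := fr.e₁_unit
      have b := fr.e₂_unit
      have o := fr.orthogonal
      simp only [form, h1, h2] at a b o
      have hA : areaForm 0 fr.pt fr.e₁ fr.e₂ = fr.e₁ 0 * fr.e₂ 1 - fr.e₁ 1 * fr.e₂ 0 := by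
        simp [areaForm, unitNormal, Matrix.det_fin_three, h1, h2]
      rw [hA]
      linear_combination (fr.e₂ 0 * fr.e₂ 0 + fr.e₂ 1 * fr.e₂ 1) * a + b
        - (fr.e₁ 0 * fr.e₂ 0 + fr.e₁ 1 * fr.e₂ 1) * o
    · set n := unitNormal c fr.pt with hn
      have hn' : n = Real.sqrt |c| • fr.pt := by rw [hn, unitNormal, if_neg hc]
      have hs : Real.sqrt |c| * Real.sqrt |c| = |c| := Real.mul_self_sqrt (abs_nonneg c)
      have n1 : form c fr.e₁ n = 0 := by
        rw [hn']
        have := fr.form_e₁_pt hc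
        simp only [form, Pi.smul_apply, smul_eq_mul] at this ⊢
        linear_combination Real.sqrt |c| * this
      have n2 : form c fr.e₂ n = 0 := by
        rw [hn']
        have := fr.form_e₂_pt hc
        simp only [form, Pi.smul_apply, smul_eq_mul] at this ⊢
        linear_combination Real.sqrt |c| * this
      have n3 : form c n n = Real.sign c := by
        have h := fr.form_pt_pt hc
        have : form c n n = |c| * form c fr.pt fr.pt := by
          rw [hn']
          simp only [form, Pi.smul_apply, smul_eq_mul]
          linear_combination (fr.pt 0 * fr.pt 0 + fr.pt 1 * fr.pt 1
            + Real.sign c * (fr.pt 2 * fr.pt 2)) * hs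
        rw [this, h, abs_eq_sign_mul]
        field_simp
      have a := fr.e₁_unit
      have b := fr.e₂_unit
      have o := fr.orthogonal
      have hmul : Matrix.of ![fr.e₁, fr.e₂, n] * Matrix.diagonal ![1, 1, Real.sign c]
          * (Matrix.of ![fr.e₁, fr.e₂, n]).transpose = Matrix.diagonal ![1, 1, Real.sign c] := by
        simp only [form] at a b o n1 n2 n3
        ext i j
        fin_cases i <;> fin_cases j <;>
          simp [Matrix.mul_apply, Matrix.vecMul, dotProduct, Fin.sum_univ_three,
            Matrix.diagonal_apply] <;> linarith
      have hdet := congrArg Matrix.det hmul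
      rw [Matrix.det_mul, Matrix.det_mul, Matrix.det_transpose, Matrix.det_diagonal,
        Fin.prod_univ_three] at hdet
      have hε : Real.sign c ≠ 0 := by rwa [Ne, Real.sign_eq_zero_iff]
      simp at hdet
      have : areaForm c fr.pt fr.e₁ fr.e₂ = Matrix.det (Matrix.of ![fr.e₁, fr.e₂, n]) := rfl
      rw [this]
      exact mul_right_cancel₀ hε (by linear_combination hdet)
  nlinarith [fr.positive]

/-- A vector is determined by its products with an orthogonal frame of the ambient space. -/
theorem eq_combo (hc : c ≠ 0) (x : Amb) :
    x = (c * form c x fr.pt) • fr.pt + form c x fr.e₁ • fr.e₁ + form c x fr.e₂ • fr.e₂ := by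
  set y : Amb := x - ((c * form c x fr.pt) • fr.pt + form c x fr.e₁ • fr.e₁
    + form c x fr.e₂ • fr.e₂) with hy
  have hp := fr.form_pt_pt hc
  have h1 := fr.form_e₁_pt hc
  have h2 := fr.form_e₂_pt hc
  have a := fr.e₁_unit
  have b := fr.e₂_unit
  have o := fr.orthogonal
  have hexp : ∀ v, form c y v = form c x v - c * form c x fr.pt * form c fr.pt v
      - form c x fr.e₁ * form c fr.e₁ v - form c x fr.e₂ * form c fr.e₂ v := by
    intro v
    simp only [hy, form, Pi.sub_apply, Pi.add_apply, Pi.smul_apply, smul_eq_mul]; ring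
  have y1 : form c y fr.e₁ = 0 := by
    rw [hexp, form_comm fr.pt, h1, a, form_comm fr.e₂, o]; ring
  have y2 : form c y fr.e₂ = 0 := by
    rw [hexp, form_comm fr.pt, h2, b, o]; ring
  have y3 : form c y fr.pt = 0 := by
    rw [hexp, hp, h1, h2]; field_simp; ring
  have hε : Real.sign c ≠ 0 := by rwa [Ne, Real.sign_eq_zero_iff]
  have hdet : Matrix.det (Matrix.of ![fr.e₁, fr.e₂, fr.pt]) ≠ 0 := by
    intro h0
    have h := fr.areaForm_frame
    have : areaForm c fr.pt fr.e₁ fr.e₂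
        = Real.sqrt |c| * Matrix.det (Matrix.of ![fr.e₁, fr.e₂, fr.pt]) := by
      simp [areaForm, unitNormal, if_neg hc, Matrix.det_fin_three]; ring
    rw [this, h0] at h
    simp at h
  have hz := Matrix.eq_zero_of_mulVec_eq_zero (v := ![y 0, y 1, Real.sign c * y 2]) hdet (by
    simp only [form] at y1 y2 y3
    ext i
    fin_cases i <;> simp [Matrix.mulVec, dotProduct, Fin.sum_univ_three] <;> linarith)
  have y0 : y = 0 := by
    ext i
    have k0 := congrFun hz 0
    have k1 := congrFun hz 1
    have k2 := congrFun hz 2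
    simp [hε] at k0 k1 k2
    fin_cases i <;> simpa
  exact sub_eq_zero.1 y0

/-- For `c = 0` the point of the frame plays no role: `e₁`, `e₂` is a basis of the plane. -/
theorem eq_combo_zero (fr : Frame 0) {x : Amb} (hx : x 2 = 0) :
    x = form 0 x fr.e₁ • fr.e₁ + form 0 x fr.e₂ • fr.e₂ := by
  have h1 : fr.e₁ 2 = 0 := by simpa [tangentPlane] using fr.e₁_mem
  have h2 : fr.e₂ 2 = 0 := by simpa [tangentPlane] using fr.e₂_mem
  have a := fr.e₁_unit
  have b := fr.e₂_unit
  have o := fr.orthogonal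
  have d := fr.areaForm_frame
  simp only [form, h1, h2] at a b o
  simp [areaForm, unitNormal, Matrix.det_fin_three, h1, h2] at d
  -- an orthonormal pair with determinant one is `(u, v), (-v, u)`
  have e1 : fr.e₂ 1 = fr.e₁ 0 := by
    linear_combination fr.e₁ 0 * d - fr.e₂ 1 * a + fr.e₁ 1 * o
  have e0 : fr.e₂ 0 = -fr.e₁ 1 := by
    linear_combination -fr.e₁ 1 * d - fr.e₂ 0 * a + fr.e₁ 0 * o
  have a' : fr.e₁ 0 ^ 2 + fr.e₁ 1 ^ 2 = 1 := by linear_combination a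
  ext i
  fin_cases i
  · simp [form, e0, e1]; linear_combination (-x 0) * a'
  · simp [form, e0, e1]; linear_combination (-x 1) * a'
  · simp [h1, h2, hx]

/-- The denominator of the stereographic coordinate. -/
noncomputable def coordDenom (fr : Frame c) (x : Amb) : ℝ :=
  1 - c / 4 * form c (x - fr.pt) (x - fr.pt)

theorem form_sub_e (hc : c ≠ 0) (x : Amb) :
    form c (x - fr.pt) fr.e₁ = form c x fr.e₁ ∧ form c (x - fr.pt) fr.e₂ = form c x fr.e₂ := by
  have h1 := fr.form_e₁_pt hc
  have h2 := fr.form_e₂_pt hc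
  simp only [form, Pi.sub_apply] at *
  constructor
  · linear_combination -h1
  · linear_combination -h2

theorem mem_surface_of_ne (hc : c ≠ 0) {x : Amb} (hx : x ∈ surface c) :
    form c x x = 1 / c ∧ (c < 0 → 0 < x 2) := by
  simpa only [surface, if_neg hc, Set.mem_ofPred_eq] using hx

theorem coordDenom_of_ne (hc : c ≠ 0) {x : Amb} (hx : x ∈ surface c) :
    fr.coordDenom x = (1 + c * form c x fr.pt) / 2 := by
  have h1 := (mem_surface_of_ne hc hx).1
  have h2 := fr.form_pt_pt hc
  have : form c (x - fr.pt) (x - fr.pt) = form c x x + form c fr.pt fr.pt - 2 * form c x fr.pt := by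
    simp only [form, Pi.sub_apply]; ring
  rw [coordDenom, this, h1, h2]
  field_simp
  ring

/-- The equation of the surface in the frame. -/
theorem sq_add_of_mem_surface (hc : c ≠ 0) {x : Amb} (hx : x ∈ surface c) :
    (c * form c x fr.pt) ^ 2 + c * (form c x fr.e₁ ^ 2 + form c x fr.e₂ ^ 2) = 1 := by
  have h1 := (mem_surface_of_ne hc hx).1
  have h2 := fr.form_combo_of_ne hc (c * form c x fr.pt) (form c x fr.e₁) (form c x fr.e₂)
    (c * form c x fr.pt) (form c x fr.e₁) (form c x fr.e₂)
  rw [← fr.eq_combo hc x, h1] at h2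
  field_simp at h2
  linear_combination -h2

/-- The denominator vanishes at most at the antipode of the centre. For `c < 0` it is positive since
the Lorentz product of two points of the upper sheet is negative. -/
theorem coordDenom_pos {x : Amb} (hx : x ∈ surface c) (h : 0 < c → x ≠ -fr.pt) :
    0 < fr.coordDenom x := by
  rcases lt_trichotomy c 0 with hc | hc | hc
  · rw [fr.coordDenom_of_ne hc.ne hx]
    obtain ⟨h1, h2⟩ := mem_surface_of_ne hc.ne hx
    obtain ⟨h3, h4⟩ := mem_surface_of_ne hc.ne fr.pt_mem
    have h2 := h2 hc
    have h4 := h4 hc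
    have hneg : form c x fr.pt < 0 := by
      simp only [form, Real.sign_of_neg hc] at h1 h3 ⊢
      have hc' : 1 / c < 0 := one_div_neg.2 hc
      have k1 : x 0 ^ 2 + x 1 ^ 2 < x 2 ^ 2 := by nlinarith
      have k2 : fr.pt 0 ^ 2 + fr.pt 1 ^ 2 < fr.pt 2 ^ 2 := by nlinarith
      have k3 : (x 0 * fr.pt 0 + x 1 * fr.pt 1) ^ 2 < (x 2 * fr.pt 2) ^ 2 := by
        have : (x 0 * fr.pt 0 + x 1 * fr.pt 1) ^ 2
            ≤ (x 0 ^ 2 + x 1 ^ 2) * (fr.pt 0 ^ 2 + fr.pt 1 ^ 2) := by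
          nlinarith [sq_nonneg (x 0 * fr.pt 1 - x 1 * fr.pt 0)]
        calc _ ≤ _ := this
          _ < x 2 ^ 2 * fr.pt 2 ^ 2 := by
            apply mul_lt_mul'' k1 k2 <;> positivity
          _ = _ := by ring
      have := abs_lt_of_sq_lt_sq k3 (by positivity)
      linarith [(abs_lt.1 this).2]
    nlinarith
  · subst hc; simp [coordDenom]
  · rw [fr.coordDenom_of_ne hc.ne' hx]
    have hs := fr.sq_add_of_mem_surface hc.ne' hx
    by_contra hneg
    have hα : c * form c x fr.pt ≤ -1 := by linarith
    have hβ : form c x fr.e₁ ^ 2 + form c x fr.e₂ ^ 2 = 0 := by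
      have hnn : 0 ≤ form c x fr.e₁ ^ 2 + form c x fr.e₂ ^ 2 := by positivity
      nlinarith
    have hβ1 : form c x fr.e₁ = 0 := by nlinarith [sq_nonneg (form c x fr.e₂)]
    have hβ2 : form c x fr.e₂ = 0 := by nlinarith [sq_nonneg (form c x fr.e₁)]
    have hα1 : c * form c x fr.pt = -1 := by
      rw [hβ] at hs
      nlinarith
    apply h hc
    rw [fr.eq_combo hc.ne' x, hβ1, hβ2, hα1]
    simp

/-- The numerator of the stereographic coordinate. -/
noncomputable def coordNum (fr : Frame c) (x : Amb) : ℂ :=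
  ⟨form c (x - fr.pt) fr.e₁, form c (x - fr.pt) fr.e₂⟩

theorem coord_eq (x : Amb) : fr.coord x = fr.coordNum x / (fr.coordDenom x : ℂ) := rfl

theorem coord_re (x : Amb) : (fr.coord x).re = form c (x - fr.pt) fr.e₁ / fr.coordDenom x := by
  rw [coord_eq, Complex.div_ofReal_re]; rfl

theorem coord_im (x : Amb) : (fr.coord x).im = form c (x - fr.pt) fr.e₂ / fr.coordDenom x := by
  rw [coord_eq, Complex.div_ofReal_im]; rfl

theorem one_add_norm_coord {x : Amb} (hx : x ∈ surface c) (h : 0 < c → x ≠ -fr.pt) :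
    1 + c / 4 * ‖fr.coord x‖ ^ 2 = (fr.coordDenom x)⁻¹ := by
  have hd := fr.coordDenom_pos hx h
  by_cases hc : c = 0
  · subst hc; simp [coordDenom]
  · rw [← Complex.normSq_eq_norm_sq, Complex.normSq_apply, coord_re, coord_im,
      (fr.form_sub_e hc x).1, (fr.form_sub_e hc x).2]
    have hs := fr.sq_add_of_mem_surface hc hx
    have hd2 := fr.coordDenom_of_ne hc hx
    have hα : c * form c x fr.pt = 2 * fr.coordDenom x - 1 := by linarith
    rw [hα] at hs
    field_simp
    linear_combination hs

theorem coord_mem_chartDomain {x : Amb} (hx : x ∈ surface c) (h : 0 < c → x ≠ -fr.pt) :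
    fr.coord x ∈ chartDomain c := by
  rw [chartDomain, Set.mem_ofPred_eq, fr.one_add_norm_coord hx h]
  exact inv_pos.2 (fr.coordDenom_pos hx h)

theorem param_coord {x : Amb} (hx : x ∈ surface c) (h : 0 < c → x ≠ -fr.pt) :
    fr.param (fr.coord x) = x := by
  have hd := fr.coordDenom_pos hx h
  have hn := fr.one_add_norm_coord hx h
  rw [param, hn, inv_inv]
  by_cases hc : c = 0
  · subst hc
    have hx2 : x 2 = 0 := by simpa [surface] using hx
    have hp2 : fr.pt 2 = 0 := by simpa [surface] using fr.pt_mem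
    have := eq_combo_zero fr (x := x - fr.pt) (by simp [hx2, hp2])
    rw [coord_re, coord_im]
    have hd1 : fr.coordDenom x = 1 := by simp [coordDenom]
    simp only [hd1, div_one, one_smul, zero_div, zero_mul, sub_zero, add_assoc]
    rw [← this]
    simp
  · have hm : 1 - c / 4 * ‖fr.coord x‖ ^ 2 = c * form c x fr.pt / fr.coordDenom x := by
      have hd2 := fr.coordDenom_of_ne hc hx
      have hα : c * form c x fr.pt = 2 * fr.coordDenom x - 1 := by linarith
      rw [hα]
      field_simp at hn ⊢
      linarith
    rw [hm, coord_re, coord_im, (fr.form_sub_e hc x).1, (fr.form_sub_e hc x).2, smul_add, smul_add,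
      smul_smul, smul_smul, smul_smul, mul_div_cancel₀ _ hd.ne', mul_div_cancel₀ _ hd.ne',
      mul_div_cancel₀ _ hd.ne']
    exact (fr.eq_combo hc x).symm

theorem param_eq_combo (w : ℂ) :
    fr.param w = (radialFactor c ‖w‖ * (1 - c / 4 * ‖w‖ ^ 2)) • fr.pt
      + (radialFactor c ‖w‖ * w.re) • fr.e₁ + (radialFactor c ‖w‖ * w.im) • fr.e₂ := by
  simp only [param, radialFactor, smul_add, smul_smul]

theorem coord_param {w : ℂ} (hw : w ∈ chartDomain c) : fr.coord (fr.param w) = w := by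
  have hw' : 0 < 1 + c / 4 * ‖w‖ ^ 2 := hw
  have hl : radialFactor c ‖w‖ * (1 + c / 4 * ‖w‖ ^ 2) = 1 := inv_mul_cancel₀ hw'.ne'
  have hl0 : radialFactor c ‖w‖ ≠ 0 := (inv_pos.2 hw').ne'
  have hn : ‖w‖ ^ 2 = w.re * w.re + w.im * w.im := by
    rw [← Complex.normSq_eq_norm_sq, Complex.normSq_apply]
  set l := radialFactor c ‖w‖ with hldef
  by_cases hc : c = 0
  · subst hc
    have hl1 : l = 1 := by simpa using hl
    have hsub : fr.param w - fr.pt = (0 : ℝ) • fr.pt + w.re • fr.e₁ + w.im • fr.e₂ := by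
      rw [param_eq_combo, ← hldef, hl1]; simp; abel
    have a := fr.e₁_unit
    have b := fr.e₂_unit
    have o := fr.orthogonal
    apply Complex.ext
    · rw [coord_re, hsub]
      simp only [form, Pi.add_apply, Pi.smul_apply, smul_eq_mul, coordDenom] at a b o ⊢
      simp
      simp at a o
      linear_combination w.re * a + w.im * o
    · rw [coord_im, hsub]
      simp only [form, Pi.add_apply, Pi.smul_apply, smul_eq_mul, coordDenom] at a b o ⊢
      simp
      simp at b o
      linear_combination w.im * b + w.re * o
  · have hsub : fr.param w - fr.pt = (l * (1 - c / 4 * ‖w‖ ^ 2) - 1) • fr.pt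
        + (l * w.re) • fr.e₁ + (l * w.im) • fr.e₂ := by
      rw [param_eq_combo, ← hldef, sub_smul]; module
    have hden : fr.coordDenom (fr.param w) = l := by
      have hm : l * (1 - c / 4 * ‖w‖ ^ 2) - 1 = c * (-(l * ‖w‖ ^ 2) / 2) := by
        linear_combination hl
      have hc2 : ∀ t : ℝ, c * t * (c * t) / c = c * t * t := fun t => by field_simp
      rw [coordDenom, hsub, form_combo_of_ne fr hc, hm, hc2]
      linear_combination (-(l * (c / 4 * ‖w‖ ^ 2)) - 1) * hl + (c / 4 * l ^ 2) * hn
    have h1 := fr.form_combo_of_ne hc (l * (1 - c / 4 * ‖w‖ ^ 2) - 1) (l * w.re) (l * w.im) 0 1 0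
    have h2 := fr.form_combo_of_ne hc (l * (1 - c / 4 * ‖w‖ ^ 2) - 1) (l * w.re) (l * w.im) 0 0 1
    simp only [zero_smul, one_smul, zero_add, add_zero] at h1 h2
    apply Complex.ext
    · rw [coord_re, hden, hsub, h1]; field_simp; ring
    · rw [coord_im, hden, hsub, h2]; field_simp; ring

end Frame

/-! ### Metric, area and geodesic curvature in the chart -/

theorem det_combo_plane (e f n : Amb) (x₁ y₁ x₂ y₂ : ℝ) :
    Matrix.det (Matrix.of ![x₁ • e + y₁ • f, x₂ • e + y₂ • f, n])
      = (x₁ * y₂ - y₁ * x₂) * Matrix.det (Matrix.of ![e, f, n]) := by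
  simp [Matrix.det_fin_three]
  ring

theorem norm_sq_eq (w : ℂ) : ‖w‖ ^ 2 = w.re * w.re + w.im * w.im := by
  rw [← Complex.normSq_eq_norm_sq, Complex.normSq_apply]

theorem radialFactor_pos {w : ℂ} (hw : w ∈ chartDomain c) : 0 < radialFactor c ‖w‖ :=
  inv_pos.2 hw

theorem radialFactor_mul {w : ℂ} (hw : w ∈ chartDomain c) :
    radialFactor c ‖w‖ * (1 + c / 4 * (w.re * w.re + w.im * w.im)) = 1 := by
  rw [← norm_sq_eq]
  exact inv_mul_cancel₀ (ne_of_gt hw)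

namespace Frame

variable (fr : Frame c)

theorem areaForm_combo_of_ne (hc : c ≠ 0) (a₁ x₁ y₁ a₂ x₂ y₂ a₃ x₃ y₃ : ℝ) :
    areaForm c (a₃ • fr.pt + x₃ • fr.e₁ + y₃ • fr.e₂) (a₁ • fr.pt + x₁ • fr.e₁ + y₁ • fr.e₂)
        (a₂ • fr.pt + x₂ • fr.e₁ + y₂ • fr.e₂)
      = a₃ * (x₁ * y₂ - y₁ * x₂) + x₃ * (y₁ * a₂ - a₁ * y₂) + y₃ * (a₁ * x₂ - x₁ * a₂) := by
  have h := fr.areaForm_frame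
  simp only [areaForm, unitNormal, if_neg hc] at h ⊢
  rw [det_combo, h, mul_one]

theorem areaForm_combo_zero (fr : Frame 0) (p : Amb) (x₁ y₁ x₂ y₂ : ℝ) :
    areaForm 0 p (x₁ • fr.e₁ + y₁ • fr.e₂) (x₂ • fr.e₁ + y₂ • fr.e₂) = x₁ * y₂ - y₁ * x₂ := by
  have h := fr.areaForm_frame
  simp only [areaForm, unitNormal, if_true] at h ⊢
  rw [det_combo_plane, h, mul_one]

/-- The differential at `w` of the stereographic parametrization, applied to `h`. -/
noncomputable def dparam (w h : ℂ) : Amb :=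
  (-(c * radialFactor c ‖w‖ ^ 2 * (w.re * h.re + w.im * h.im))) • fr.pt
    + (radialFactor c ‖w‖ * h.re
        - radialFactor c ‖w‖ ^ 2 * (c / 2) * (w.re * h.re + w.im * h.im) * w.re) • fr.e₁
    + (radialFactor c ‖w‖ * h.im
        - radialFactor c ‖w‖ ^ 2 * (c / 2) * (w.re * h.re + w.im * h.im) * w.im) • fr.e₂

theorem dparam_neg (w h : ℂ) : fr.dparam w (-h) = -fr.dparam w h := by
  simp only [dparam, Complex.neg_re, Complex.neg_im]
  module

/-- The parametrization is conformal, with conformal factor `radialFactor`. -/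
theorem form_dparam {w : ℂ} (hw : w ∈ chartDomain c) (h k : ℂ) :
    form c (fr.dparam w h) (fr.dparam w k)
      = radialFactor c ‖w‖ ^ 2 * (h.re * k.re + h.im * k.im) := by
  have hl := radialFactor_mul hw
  set l := radialFactor c ‖w‖
  by_cases hc : c = 0
  · subst hc
    rw [dparam, dparam, form_combo, fr.e₁_unit, fr.e₂_unit, fr.orthogonal]
    ring
  · rw [dparam, dparam, form_combo_of_ne fr hc]
    have hc2 : ∀ s t : ℝ, -(c * l ^ 2 * s) * -(c * l ^ 2 * t) / c = c * l ^ 4 * s * t :=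
      fun s t => by field_simp
    rw [hc2]
    linear_combination (c * (w.re * h.re + w.im * h.im) * (w.re * k.re + w.im * k.im) * l ^ 3) * hl

theorem areaForm_dparam {w : ℂ} (hw : w ∈ chartDomain c) (h k : ℂ) :
    areaForm c (fr.param w) (fr.dparam w h) (fr.dparam w k)
      = radialFactor c ‖w‖ ^ 2 * (h.re * k.im - h.im * k.re) := by
  have hl := radialFactor_mul hw
  by_cases hc : c = 0
  · subst hc
    have hd : ∀ h, fr.dparam w h
        = (radialFactor 0 ‖w‖ * h.re) • fr.e₁ + (radialFactor 0 ‖w‖ * h.im) • fr.e₂ := by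
      intro h; simp [dparam]
    rw [hd, hd, areaForm_combo_zero]
    ring
  · rw [param_eq_combo, dparam, dparam, areaForm_combo_of_ne fr hc, norm_sq_eq]
    set l := radialFactor c ‖w‖
    linear_combination ((h.re * k.im - h.im * k.re) * l ^ 2
      * (1 + 2 * (l * (c / 4 * (w.re * w.re + w.im * w.im))))) * hl

theorem hasDerivAt_radialFactor {z : ℝ → ℂ} {z' : ℂ} {s : ℝ} (hz : HasDerivAt z z' s)
    (hw : z s ∈ chartDomain c) :
    HasDerivAt (fun t => radialFactor c ‖z t‖)
      (-(radialFactor c ‖z s‖ ^ 2 * (c / 2 * ((z s).re * z'.re + (z s).im * z'.im)))) s := by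
  have hx : HasDerivAt (fun t => (z t).re) z'.re s :=
    Complex.reCLM.hasFDerivAt.comp_hasDerivAt s hz
  have hy : HasDerivAt (fun t => (z t).im) z'.im s :=
    Complex.imCLM.hasFDerivAt.comp_hasDerivAt s hz
  have h := ((((hx.mul hx).add (hy.mul hy)).const_mul (c / 4)).const_add 1).inv (by
    have h0 : 1 + c / 4 * ‖z s‖ ^ 2 ≠ 0 := ne_of_gt hw
    rwa [norm_sq_eq] at h0)
  refine (h.congr_of_eventuallyEq (Eventually.of_forall fun t => ?_)).congr_deriv ?_
  · simp [radialFactor, norm_sq_eq]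
  · simp only [radialFactor, norm_sq_eq, Pi.add_apply, Pi.mul_apply]
    rw [inv_pow, div_eq_inv_mul]
    ring

/-- The chain rule for the parametrization, with the differential in closed form. -/
theorem hasDerivAt_param_comp {z : ℝ → ℂ} {z' : ℂ} {s : ℝ} (hz : HasDerivAt z z' s)
    (hw : z s ∈ chartDomain c) :
    HasDerivAt (fun t => fr.param (z t)) (fr.dparam (z s) z') s := by
  have hx : HasDerivAt (fun t => (z t).re) z'.re s :=
    Complex.reCLM.hasFDerivAt.comp_hasDerivAt s hz
  have hy : HasDerivAt (fun t => (z t).im) z'.im s :=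
    Complex.imCLM.hasFDerivAt.comp_hasDerivAt s hz
  have hl := hasDerivAt_radialFactor hz hw
  have hr := radialFactor_mul hw
  have hq := (((hx.mul hx).add (hy.mul hy)).const_mul (c / 4)).const_sub 1
  have h := (((hl.mul hq).smul_const fr.pt).add ((hl.mul hx).smul_const fr.e₁)).add
    ((hl.mul hy).smul_const fr.e₂)
  refine (h.congr_of_eventuallyEq (Eventually.of_forall fun t => ?_)).congr_deriv ?_
  · simp [param_eq_combo, norm_sq_eq]
  · simp only [dparam, Pi.add_apply, Pi.mul_apply]
    congr 1
    · congr 1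
      · congr 1
        linear_combination (radialFactor c ‖z s‖ * (c / 2)
          * ((z s).re * z'.re + (z s).im * z'.im)) * hr
      · congr 1; ring
    · congr 1; ring

theorem differentiableAt_param {w : ℂ} (hw : w ∈ chartDomain c) :
    DifferentiableAt ℝ fr.param w := by
  have h0 : (1 + c / 4 * ‖w‖ ^ 2) ≠ 0 := ne_of_gt hw
  have hn : DifferentiableAt ℝ (fun w : ℂ => ‖w‖ ^ 2) w := differentiableAt_id.norm_sq ℝ
  have hre : DifferentiableAt ℝ (fun w : ℂ => w.re) w := Complex.reCLM.differentiableAt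
  have him : DifferentiableAt ℝ (fun w : ℂ => w.im) w := Complex.imCLM.differentiableAt
  unfold Frame.param
  exact (((hn.const_mul _).const_add 1).inv h0).smul
    (((((hn.const_mul _).const_sub 1).smul_const _).add (hre.smul_const _)).add
      (him.smul_const _))

theorem fderiv_param {w : ℂ} (hw : w ∈ chartDomain c) (h : ℂ) :
    fderiv ℝ fr.param w h = fr.dparam w h := by
  have hline : HasDerivAt (fun t : ℝ => w + (t : ℂ) * h) h 0 := by
    simpa using ((Complex.ofRealCLM.hasDerivAt (x := (0 : ℝ))).mul_const h).const_add w
  have h1 := fr.hasDerivAt_param_comp hline (by simpa using hw)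
  have h2 : HasFDerivAt fr.param (fderiv ℝ fr.param w) (w + ((0 : ℝ) : ℂ) * h) := by
    simpa using (fr.differentiableAt_param hw).hasFDerivAt
  have h3 := h2.comp_hasDerivAt (0 : ℝ) hline
  simpa using h3.unique h1

/-- Geodesic curvature in the chart. The three vectors `γ', γ'', γ` have the same determinant,
up to `radialFactor ^ 3`, as the ones obtained from `γ` by clearing its denominator. -/
theorem geodesicCurvature_param_comp {z : ℝ → ℂ} {s : ℝ} (hz : ContDiffAt ℝ 2 z s)
    (hw : z s ∈ chartDomain c) :
    geodesicCurvature c (fun t => fr.param (z t)) s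
      = radialFactor c ‖z s‖ ^ 2 * ((starRingEnd ℂ) (deriv z s) * deriv (deriv z) s).im
        - c / 2 * radialFactor c ‖z s‖ ^ 3 * ‖deriv z s‖ ^ 2
          * ((starRingEnd ℂ) (z s) * deriv z s).im := by
  have hopen : IsOpen (chartDomain c) := isOpen_lt continuous_const (by fun_prop)
  have hev1 : ∀ᶠ t in 𝓝 s, HasDerivAt z (deriv z t) t :=
    (hz.eventually (by simp)).mono fun t ht => (ht.differentiableAt (by simp)).hasDerivAt
  have hev2 : ∀ᶠ t in 𝓝 s, z t ∈ chartDomain c := hz.continuousAt (hopen.mem_nhds hw)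
  have hz1 := hev1.self_of_nhds
  have hz2 : HasDerivAt (deriv z) (deriv (deriv z) s) s :=
    ((ContDiffAt.derivWithin (m := 1) hz (by norm_num)).differentiableAt (by simp)).hasDerivAt
  have re' : ∀ {f : ℝ → ℂ} {f' : ℂ} {t : ℝ}, HasDerivAt f f' t →
      HasDerivAt (fun t => (f t).re) f'.re t := fun h =>
    Complex.reCLM.hasFDerivAt.comp_hasDerivAt _ h
  have im' : ∀ {f : ℝ → ℂ} {f' : ℂ} {t : ℝ}, HasDerivAt f f' t →
      HasDerivAt (fun t => (f t).im) f'.im t := fun h =>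
    Complex.imCLM.hasFDerivAt.comp_hasDerivAt _ h
  -- `γ = l • Y` with `Y` the numerator of the parametrization
  set A : ℝ → ℝ := fun t => (z t).re * (deriv z t).re + (z t).im * (deriv z t).im with hA
  set l : ℝ → ℝ := fun t => radialFactor c ‖z t‖ with hl
  set l' : ℝ → ℝ := fun t => -(l t ^ 2 * (c / 2 * A t)) with hl'
  set Y : ℝ → Amb := fun t => (1 - c / 4 * ((z t).re * (z t).re + (z t).im * (z t).im)) • fr.pt
    + (z t).re • fr.e₁ + (z t).im • fr.e₂ with hY
  set Y' : ℝ → Amb := fun t => (-(c / 2 * A t)) • fr.pt + (deriv z t).re • fr.e₁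
    + (deriv z t).im • fr.e₂ with hY'
  have hγ : (fun t => fr.param (z t)) = fun t => l t • Y t := by
    funext t
    simp only [param_eq_combo, norm_sq_eq, hl, hY, smul_add, smul_smul]
  have hY1 : ∀ {t}, HasDerivAt z (deriv z t) t → HasDerivAt Y (Y' t) t := by
    intro t h
    have hq := ((((re' h).mul (re' h)).add ((im' h).mul (im' h))).const_mul (c / 4)).const_sub 1
    refine (((hq.smul_const fr.pt).add ((re' h).smul_const fr.e₁)).add
      ((im' h).smul_const fr.e₂)).congr_deriv ?_
    simp only [hY', hA]
    congr 3
    ring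
  have hA1 := ((re' hz1).mul (re' hz2)).add ((im' hz1).mul (im' hz2))
  set A' : ℝ := (deriv z s).re * (deriv z s).re + (z s).re * (deriv (deriv z) s).re
    + ((deriv z s).im * (deriv z s).im + (z s).im * (deriv (deriv z) s).im) with hA'
  set Y'' : Amb := (-(c / 2 * A')) • fr.pt + (deriv (deriv z) s).re • fr.e₁
    + (deriv (deriv z) s).im • fr.e₂ with hY''
  have hY2 : HasDerivAt Y' Y'' s := (((hA1.const_mul (c / 2)).neg.smul_const fr.pt).add
    ((re' hz2).smul_const fr.e₁)).add ((im' hz2).smul_const fr.e₂)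
  have hl1 : ∀ᶠ t in 𝓝 s, HasDerivAt l (l' t) t := by
    filter_upwards [hev1, hev2] with t h1 h2 using hasDerivAt_radialFactor h1 h2
  obtain ⟨l'', hl2⟩ : ∃ l'', HasDerivAt l' l'' s :=
    ⟨_, ((hl1.self_of_nhds.pow 2).mul (hA1.const_mul (c / 2))).neg⟩
  have hd1 : deriv (fun t => l t • Y t) =ᶠ[𝓝 s] fun t => l t • Y' t + l' t • Y t := by
    filter_upwards [hev1, hl1] with t h1 h2 using (h2.smul (hY1 h1)).deriv
  have hdd : deriv (deriv fun t => l t • Y t) s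
      = l s • Y'' + l' s • Y' s + (l' s • Y' s + l'' • Y s) :=
    (((hl1.self_of_nhds.smul hY2).add (hl2.smul (hY1 hz1))).congr_of_eventuallyEq hd1).deriv
  have hmul := radialFactor_mul hw
  have hγs : fr.param (z s) = l s • Y s := congrFun hγ s
  rw [geodesicCurvature, hγ, hdd, hd1.self_of_nhds]
  simp only [Complex.mul_im, Complex.conj_re, Complex.conj_im, norm_sq_eq, tangentialPart]
  rw [hγs]
  generalize form c _ (l s • Y s) = k
  change l s * _ = 1 at hmul
  change _ = l s ^ 2 * _ - c / 2 * l s ^ 3 * _ * _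
  by_cases hc : c = 0
  · subst hc
    -- `Y` has a component along `fr.pt`, which is harmless because `l` is constant
    have hl0 : l' = fun _ => 0 := by funext t; simp [hl']
    have hl'' : l'' = 0 := by
      rw [hl0] at hl2
      exact hl2.unique (hasDerivAt_const s 0)
    have hr : l s = 1 := by simpa using hmul
    have e1 : l s • Y' s + l' s • Y s = (deriv z s).re • fr.e₁ + (deriv z s).im • fr.e₂ := by
      simp [hl0, hr, hY']
    have e2 : l s • Y'' + l' s • Y' s + (l' s • Y' s + l'' • Y s) - (0 * k) • l s • Y s
        = (deriv (deriv z) s).re • fr.e₁ + (deriv (deriv z) s).im • fr.e₂ := by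
      simp [hl0, hr, hY'', hl'']
    rw [e1, e2, areaForm_combo_zero, hr]
    ring
  · have e1 : l s • Y' s + l' s • Y s
        = (l s * (-(c / 2 * A s))
            + l' s * (1 - c / 4 * ((z s).re * (z s).re + (z s).im * (z s).im))) • fr.pt
          + (l s * (deriv z s).re + l' s * (z s).re) • fr.e₁
          + (l s * (deriv z s).im + l' s * (z s).im) • fr.e₂ := by
      simp only [hY', hY]; module
    have e2 : l s • Y'' + l' s • Y' s + (l' s • Y' s + l'' • Y s) - (c * k) • l s • Y s
        = (l s * (-(c / 2 * A')) + 2 * l' s * (-(c / 2 * A s))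
            + (l'' - c * k * l s)
              * (1 - c / 4 * ((z s).re * (z s).re + (z s).im * (z s).im))) • fr.pt
          + (l s * (deriv (deriv z) s).re + 2 * l' s * (deriv z s).re
              + (l'' - c * k * l s) * (z s).re) • fr.e₁
          + (l s * (deriv (deriv z) s).im + 2 * l' s * (deriv z s).im
              + (l'' - c * k * l s) * (z s).im) • fr.e₂ := by
      simp only [hY'', hY', hY]; module
    have e3 : l s • Y s
        = (l s * (1 - c / 4 * ((z s).re * (z s).re + (z s).im * (z s).im))) • fr.pt
          + (l s * (z s).re) • fr.e₁ + (l s * (z s).im) • fr.e₂ := by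
      simp only [hY]; module
    rw [e1, e2, e3, areaForm_combo_of_ne fr hc]
    have hAs : A s = (z s).re * (deriv z s).re + (z s).im * (deriv z s).im := rfl
    rw [hAs, hA']
    generalize l' s = r'
    generalize l s = r at hmul ⊢
    linear_combination (r ^ 2 * ((deriv z s).re * (deriv (deriv z) s).im
      - (deriv z s).im * (deriv (deriv z) s).re)) * hmul

end Frame

/-! ### The area measure in the chart -/

namespace Frame

variable (fr : Frame c)

theorem contDiff_form {f g : Amb → Amb} (hf : ContDiff ℝ ⊤ f) (hg : ContDiff ℝ ⊤ g) :
    ContDiff ℝ ⊤ fun x => form c (f x) (g x) := by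
  have hf' := contDiff_pi.1 hf
  have hg' := contDiff_pi.1 hg
  unfold form
  exact (((hf' 0).mul (hg' 0)).add ((hf' 1).mul (hg' 1))).add
    (contDiff_const.mul ((hf' 2).mul (hg' 2)))

theorem contDiff_coordDenom : ContDiff ℝ ⊤ fr.coordDenom := by
  have hs : ContDiff ℝ ⊤ fun x : Amb => x - fr.pt := contDiff_id.sub contDiff_const
  exact contDiff_const.sub (contDiff_const.mul (contDiff_form hs hs))

theorem contDiff_coordNum : ContDiff ℝ ⊤ fr.coordNum := by
  have hs : ContDiff ℝ ⊤ fun x : Amb => x - fr.pt := contDiff_id.sub contDiff_const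
  have h := (Complex.ofRealCLM.contDiff.comp
      (contDiff_form (c := c) hs (contDiff_const (c := fr.e₁)))).add
    ((Complex.ofRealCLM.contDiff.comp
      (contDiff_form (c := c) hs (contDiff_const (c := fr.e₂)))).mul
        (contDiff_const (c := Complex.I)))
  have e : fr.coordNum = fun x => (form c (x - fr.pt) fr.e₁ : ℂ)
      + (form c (x - fr.pt) fr.e₂ : ℂ) * Complex.I :=
    funext fun x => Complex.mk_eq_add_mul_I _ _
  rw [e]
  exact h

theorem contDiffAt_coord {x : Amb} (hx : fr.coordDenom x ≠ 0) : ContDiffAt ℝ 2 fr.coord x := by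
  have h1 : ContDiffAt ℝ 2 fr.coordNum x := (fr.contDiff_coordNum.of_le le_top).contDiffAt
  have h2 : ContDiffAt ℝ 2 (fun x => (fr.coordDenom x : ℂ)) x :=
    Complex.ofRealCLM.contDiff.contDiffAt.comp x
      (fr.contDiff_coordDenom.of_le le_top).contDiffAt
  have := h1.mul (h2.inv (by exact_mod_cast hx))
  exact this.congr_of_eventuallyEq (Eventually.of_forall fun y => by
    rw [coord_eq, div_eq_mul_inv]; rfl)

theorem measurable_coord : Measurable fr.coord := by
  have h1 := fr.contDiff_coordNum.continuous.measurable
  have h2 := Complex.measurable_ofReal.comp fr.contDiff_coordDenom.continuous.measurable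
  exact h1.div h2

theorem measurable_param : Measurable fr.param := by
  unfold Frame.param
  have h0 : Measurable fun w : ℂ => (1 + c / 4 * ‖w‖ ^ 2)⁻¹ := by fun_prop
  have h1 : Measurable fun w : ℂ => (1 - c / 4 * ‖w‖ ^ 2) • fr.pt :=
    (by fun_prop : Measurable fun w : ℂ => 1 - c / 4 * ‖w‖ ^ 2).smul_const _
  exact h0.smul ((h1.add (Complex.measurable_re.smul_const _)).add
    (Complex.measurable_im.smul_const _))

/-- The area measure of the surface, transported to the chart. -/
noncomputable def chartMeasure (c : ℝ) : Measure ℂ :=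
  (volume.restrict (chartDomain c)).withDensity fun w => ENNReal.ofReal (radialFactor c ‖w‖ ^ 2)

theorem areaMeasure_eq : fr.areaMeasure = (chartMeasure c).map fr.param := by
  rw [areaMeasure, chartMeasure]
  congr 1
  refine withDensity_congr_ae ?_
  filter_upwards [ae_restrict_mem measurableSet_chartDomain] with w hw
  rw [fr.fderiv_param hw, fr.fderiv_param hw, fr.areaForm_dparam hw]
  simp

theorem map_coord_areaMeasure : fr.areaMeasure.map fr.coord = chartMeasure c := by
  rw [areaMeasure_eq, Measure.map_map fr.measurable_coord fr.measurable_param]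
  have : fr.coord ∘ fr.param =ᵐ[chartMeasure c] id := by
    refine (withDensity_absolutelyContinuous _ _).ae_le ?_
    filter_upwards [ae_restrict_mem measurableSet_chartDomain] with w hw
      using fr.coord_param hw
  rw [Measure.map_congr this, Measure.map_id]

theorem measurable_density :
    Measurable fun w : ℂ => ENNReal.ofReal (radialFactor c ‖w‖ ^ 2) := by
  unfold radialFactor; fun_prop

theorem integrable_areaMeasure {h : ℂ → ℝ}
    (hi : IntegrableOn (fun w => radialFactor c ‖w‖ ^ 2 * h w) (chartDomain c)) :
    Integrable (fun p => h (fr.coord p)) fr.areaMeasure := by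
  have h1 : Integrable h (fr.areaMeasure.map fr.coord) := by
    rw [map_coord_areaMeasure, chartMeasure,
      integrable_withDensity_iff_integrable_smul' measurable_density (by simp)]
    simpa [ENNReal.toReal_ofReal (sq_nonneg _), IntegrableOn] using hi
  exact h1.comp_measurable fr.measurable_coord

theorem integral_areaMeasure {h : ℂ → ℝ}
    (hi : IntegrableOn (fun w => radialFactor c ‖w‖ ^ 2 * h w) (chartDomain c)) :
    ∫ p, h (fr.coord p) ∂fr.areaMeasure
      = ∫ w in chartDomain c, radialFactor c ‖w‖ ^ 2 * h w := by
  have h1 : Integrable h (fr.areaMeasure.map fr.coord) := by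
    rw [map_coord_areaMeasure, chartMeasure,
      integrable_withDensity_iff_integrable_smul' measurable_density (by simp)]
    simpa [ENNReal.toReal_ofReal (sq_nonneg _), IntegrableOn] using hi
  rw [← integral_map fr.measurable_coord.aemeasurable h1.aestronglyMeasurable,
    map_coord_areaMeasure, chartMeasure,
    integral_withDensity_eq_integral_toReal_smul measurable_density (by simp)]
  simp [ENNReal.toReal_ofReal (sq_nonneg _)]

end Frame

/-! ### One-sided limits and singular parameters -/

/-- A locally bounded function is bounded on compact sets; no continuity is assumed. -/
theorem bounded_of_locally_bounded {E : Type*} [NormedAddCommGroup E] {f : ℝ → E} {K : Set ℝ}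
    (hK : IsCompact K) (h : ∀ s ∈ K, ∃ C, ∀ᶠ t in 𝓝 s, ‖f t‖ ≤ C) :
    ∃ C, ∀ s ∈ K, ‖f s‖ ≤ C := by
  refine hK.induction_on (p := fun A => ∃ C, ∀ s ∈ A, ‖f s‖ ≤ C) ⟨0, by simp⟩ ?_ ?_ ?_
  · rintro A B hAB ⟨C, hC⟩
    exact ⟨C, fun s hs => hC s (hAB hs)⟩
  · rintro A B ⟨C, hC⟩ ⟨D, hD⟩
    refine ⟨max C D, ?_⟩
    rintro s (hs | hs)
    · exact (hC s hs).trans (le_max_left _ _)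
    · exact (hD s hs).trans (le_max_right _ _)
  · intro s hs
    obtain ⟨C, hC⟩ := h s hs
    exact ⟨_, mem_nhdsWithin_of_mem_nhds hC, C, fun t ht => ht⟩

theorem locally_bounded_of_limits {E : Type*} [NormedAddCommGroup E] {f : ℝ → E} {a : ℝ} {u v : E}
    (hl : Tendsto f (𝓝[<] a) (𝓝 u)) (hr : Tendsto f (𝓝[>] a) (𝓝 v)) :
    ∃ C, ∀ᶠ t in 𝓝 a, ‖f t‖ ≤ C := by
  have h1 : ∀ᶠ t in 𝓝[<] a, ‖f t‖ ≤ ‖u‖ + 1 :=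
    (hl.norm.eventually_lt_const (lt_add_one _)).mono fun _ => le_of_lt
  have h2 : ∀ᶠ t in 𝓝[>] a, ‖f t‖ ≤ ‖v‖ + 1 :=
    (hr.norm.eventually_lt_const (lt_add_one _)).mono fun _ => le_of_lt
  refine ⟨max (‖f a‖) (max (‖u‖ + 1) (‖v‖ + 1)), ?_⟩
  rw [← pure_sup_nhdsNE, ← Set.Iio_union_Ioi, nhdsWithin_union]
  refine eventually_sup.2 ⟨by simp, eventually_sup.2 ⟨?_, ?_⟩⟩
  · exact h1.mono fun t ht => ht.trans ((le_max_left _ _).trans (le_max_right _ _))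
  · exact h2.mono fun t ht => ht.trans ((le_max_right _ _).trans (le_max_right _ _))

theorem periodic_deriv {E : Type*} [NormedAddCommGroup E] [NormedSpace ℝ E] {f : ℝ → E} {L : ℝ}
    (h : Function.Periodic f L) : Function.Periodic (deriv f) L := by
  intro s
  rw [← deriv_comp_add_const]
  congr 1
  funext t
  exact h t

theorem tendsto_periodic {E : Type*} {f : ℝ → E} {F : Filter E} {L : ℝ}
    (h : Function.Periodic f L) (m : ℤ) (a : ℝ) :
    (Tendsto f (𝓝[<] a) F → Tendsto f (𝓝[<] (a + m * L)) F) ∧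
    (Tendsto f (𝓝[>] a) F → Tendsto f (𝓝[>] (a + m * L)) F) := by
  have hf : f = f ∘ fun t => t - m * L := by
    funext t
    exact (h.sub_int_mul_eq m).symm
  have hc : ∀ s, Tendsto (fun t : ℝ => t - m * L) (𝓝 s) (𝓝 (s - m * L)) := fun s =>
    (continuous_id.sub continuous_const).tendsto s
  constructor
  · intro ht
    rw [hf]
    refine ht.comp (tendsto_nhdsWithin_iff.2 ⟨?_, ?_⟩)
    · have := (hc (a + m * L)).mono_left (nhdsWithin_le_nhds (s := Set.Iio (a + m * L)))
      simpa using this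
    · filter_upwards [self_mem_nhdsWithin] with t ht
      exact sub_lt_iff_lt_add.2 (Set.mem_Iio.1 ht)
  · intro ht
    rw [hf]
    refine ht.comp (tendsto_nhdsWithin_iff.2 ⟨?_, ?_⟩)
    · have := (hc (a + m * L)).mono_left (nhdsWithin_le_nhds (s := Set.Ioi (a + m * L)))
      simpa using this
    · filter_upwards [self_mem_nhdsWithin] with t ht
      exact lt_sub_iff_add_lt.2 (Set.mem_Ioi.1 ht)

variable {L : ℝ} {S : Finset ℝ} {γ : ℝ → Amb}

namespace IsClosedPiecewiseC2

/-- The singular parameters form a discrete closed set. -/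
theorem eventually_not_singular (hL : 0 < L) (S : Finset ℝ) (a : ℝ) :
    ∀ᶠ t in 𝓝[≠] a, ¬ IsSingularParam L S t := by
  have h1 : ∀ b ∈ S, ∀ᶠ t in 𝓝[≠] a, ∀ m : ℤ, t ≠ b + m * L := by
    intro b _
    have hfin : {m : ℤ | |b + m * L - a| ≤ 1}.Finite := by
      refine (Set.finite_Icc ⌊(a - 1 - b) / L⌋ ⌈(a + 1 - b) / L⌉).subset fun m hm => ?_
      have hm' := abs_le.1 (show |b + m * L - a| ≤ 1 from hm)
      have e1 : (a - 1 - b) / L ≤ m := by rw [div_le_iff₀ hL]; linarith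
      have e2 : (m : ℝ) ≤ (a + 1 - b) / L := by rw [le_div_iff₀ hL]; linarith
      exact ⟨by exact_mod_cast (Int.floor_le _).trans e1,
        by exact_mod_cast e2.trans (Int.le_ceil _)⟩
    have hfin' := (hfin.image fun m : ℤ => b + m * L).subset
      (Set.sdiff_subset (t := {a}))
    have h2 : ∀ᶠ t in 𝓝 a, t ∉ ((fun m : ℤ => b + m * L) '' {m : ℤ | |b + m * L - a| ≤ 1}) \ {a} :=
      hfin'.isClosed.isOpen_compl.mem_nhds (by simp)
    have h3 : ∀ᶠ t in 𝓝 a, |t - a| ≤ 1 := by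
      filter_upwards [Metric.closedBall_mem_nhds a one_pos] with t ht using by
        simpa [Real.dist_eq] using ht
    filter_upwards [self_mem_nhdsWithin, nhdsWithin_le_nhds h2, nhdsWithin_le_nhds h3]
      with t ht h2 h3 m hm
    exact h2 ⟨⟨m, by rw [hm] at h3; exact h3, hm.symm⟩, ht⟩
  filter_upwards [(S.eventually_all).2 h1] with t ht
  rintro ⟨b, hb, m, hm⟩
  exact ht b hb m hm

theorem not_singular (hγ : IsClosedPiecewiseC2 c L S γ) {s : ℝ} (hs : s ∈ Set.Ico 0 L)
    (hsS : s ∉ S) : ¬ IsSingularParam L S s := by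
  rintro ⟨a, ha, m, hm⟩
  have ha' := hγ.singular_mem a ha
  have hL := hγ.length_pos
  have h1 : (m : ℝ) < 1 := by
    by_contra h
    nlinarith [ha'.1, hs.2, not_lt.1 h]
  have h2 : (-1 : ℝ) < m := by
    by_contra h
    nlinarith [ha'.2, hs.1, not_lt.1 h]
  have h1' : m < 1 := by exact_mod_cast h1
  have h2' : -1 < m := by exact_mod_cast h2
  have : m = 0 := by omega
  rw [this] at hm
  simp at hm
  exact hsS (hm ▸ ha)

theorem eventually_nhds_not_singular (hγ : IsClosedPiecewiseC2 c L S γ) {s : ℝ}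
    (hs : ¬ IsSingularParam L S s) : ∀ᶠ t in 𝓝 s, ¬ IsSingularParam L S t := by
  rw [← pure_sup_nhdsNE]
  exact eventually_sup.2 ⟨hs, eventually_not_singular hγ.length_pos S s⟩

theorem eventually_left (hγ : IsClosedPiecewiseC2 c L S γ) (a : ℝ) :
    ∀ᶠ t in 𝓝[<] a, ¬ IsSingularParam L S t :=
  (eventually_not_singular hγ.length_pos S a).filter_mono
    (nhdsWithin_mono _ fun _ h => ne_of_lt h)

theorem eventually_right (hγ : IsClosedPiecewiseC2 c L S γ) (a : ℝ) :
    ∀ᶠ t in 𝓝[>] a, ¬ IsSingularParam L S t :=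
  (eventually_not_singular hγ.length_pos S a).filter_mono
    (nhdsWithin_mono _ fun _ h => ne_of_gt h)

/-- One-sided limits at the points of `S` give one-sided limits everywhere, by periodicity. -/
theorem hasOneSidedLimits_of_periodic {f : ℝ → Amb} (hf : Function.Periodic f L)
    (h1 : ∀ a ∈ S, HasOneSidedLimits f a)
    (h2 : ∀ s, ¬ IsSingularParam L S s → ContinuousAt f s) (s : ℝ) : HasOneSidedLimits f s := by
  by_cases hs : IsSingularParam L S s
  · obtain ⟨a, ha, m, rfl⟩ := hs
    obtain ⟨⟨u, hu⟩, v, hv⟩ := h1 a ha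
    exact ⟨⟨u, (tendsto_periodic hf m a).1 hu⟩, v, (tendsto_periodic hf m a).2 hv⟩
  · exact ⟨⟨_, (h2 s hs).tendsto.mono_left nhdsWithin_le_nhds⟩,
      _, (h2 s hs).tendsto.mono_left nhdsWithin_le_nhds⟩

theorem continuousAt_deriv (hγ : IsClosedPiecewiseC2 c L S γ) {s : ℝ}
    (hs : ¬ IsSingularParam L S s) : ContinuousAt (deriv γ) s :=
  (ContDiffAt.derivWithin (m := 1) (hγ.contDiffAt s hs) (by norm_num)).continuousAt

theorem continuousAt_deriv_deriv (hγ : IsClosedPiecewiseC2 c L S γ) {s : ℝ}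
    (hs : ¬ IsSingularParam L S s) : ContinuousAt (deriv (deriv γ)) s :=
  (ContDiffAt.derivWithin (m := 0)
    (ContDiffAt.derivWithin (m := 1) (hγ.contDiffAt s hs) (by norm_num)) (by norm_num)).continuousAt

theorem hasOneSidedLimits_deriv (hγ : IsClosedPiecewiseC2 c L S γ) (s : ℝ) :
    HasOneSidedLimits (deriv γ) s :=
  hasOneSidedLimits_of_periodic (periodic_deriv hγ.periodic) hγ.oneSided
    (fun _ => hγ.continuousAt_deriv) s

theorem continuous_curvature :
    Continuous fun q : Amb × Amb × Amb => areaForm c q.1 q.2.1 (tangentialPart c q.1 q.2.2) := by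
  have hf : Continuous fun q : Amb × Amb × Amb => form c q.2.2 q.1 := by
    unfold form; fun_prop
  have ht : Continuous fun q : Amb × Amb × Amb => tangentialPart c q.1 q.2.2 := by
    unfold tangentialPart; fun_prop
  have hn : Continuous fun q : Amb × Amb × Amb => unitNormal c q.1 := by
    unfold unitNormal
    split_ifs <;> fun_prop
  simp only [areaForm, Matrix.det_fin_three, Matrix.of_apply, Matrix.cons_val]
  fun_prop

/-- If the second derivative has one-sided limits as well, the geodesic curvature is bounded. -/
theorem intervalIntegrable_geodesicCurvature (hγ : IsClosedPiecewiseC2 c L S γ)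
    (h : ∀ a ∈ S, HasOneSidedLimits (deriv (deriv γ)) a) :
    IntervalIntegrable (geodesicCurvature c γ) volume 0 L := by
  have hlim := hasOneSidedLimits_of_periodic (periodic_deriv (periodic_deriv hγ.periodic)) h
    (fun _ => hγ.continuousAt_deriv_deriv)
  obtain ⟨G, hG, hk⟩ : ∃ G : Amb × Amb × Amb → ℝ, Continuous G ∧
      geodesicCurvature c γ = G ∘ fun s => (γ s, deriv γ s, deriv (deriv γ) s) :=
    ⟨_, continuous_curvature, rfl⟩
  rw [hk]
  have hloc : ∀ s ∈ Set.Icc 0 L,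
      ∃ C, ∀ᶠ t in 𝓝 s, ‖(G ∘ fun s => (γ s, deriv γ s, deriv (deriv γ) s)) t‖ ≤ C := by
    intro s _
    obtain ⟨⟨u₁, hu₁⟩, v₁, hv₁⟩ := hγ.hasOneSidedLimits_deriv s
    obtain ⟨⟨u₂, hu₂⟩, v₂, hv₂⟩ := hlim s
    have hc := hγ.continuous.tendsto s
    exact locally_bounded_of_limits
      ((hG.tendsto (γ s, u₁, u₂)).comp
        ((hc.mono_left nhdsWithin_le_nhds).prodMk_nhds (hu₁.prodMk_nhds hu₂)))
      ((hG.tendsto (γ s, v₁, v₂)).comp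
        ((hc.mono_left nhdsWithin_le_nhds).prodMk_nhds (hv₁.prodMk_nhds hv₂)))
  obtain ⟨C, hC⟩ := bounded_of_locally_bounded isCompact_Icc hloc
  rw [intervalIntegrable_iff_integrableOn_Ioc_of_le hγ.length_pos.le]
  refine Measure.integrableOn_of_bounded (M := C) (by simp) ?_ ?_
  · have : Measurable fun s => (γ s, deriv γ s, deriv (deriv γ) s) :=
      hγ.continuous.measurable.prodMk ((measurable_deriv γ).prodMk (measurable_deriv _))
    exact (hG.measurable.comp this).aestronglyMeasurable
  · exact (ae_restrict_mem measurableSet_Ioc).mono fun s hs => hC s (Set.Ioc_subset_Icc_self hs)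

/-! ### The curve in the chart -/

section Chart

variable (hγ : IsClosedPiecewiseC2 c L S γ) (fr : Frame c) (hfr : 0 < c → ∀ s, γ s ≠ -fr.pt)

include hγ hfr

theorem coordDenom_pos (s : ℝ) : 0 < fr.coordDenom (γ s) :=
  fr.coordDenom_pos (hγ.mem_surface s) fun hc => hfr hc s

theorem chart_mem (s : ℝ) : fr.coord (γ s) ∈ chartDomain c :=
  fr.coord_mem_chartDomain (hγ.mem_surface s) fun hc => hfr hc s

theorem eq_param_chart : γ = fun t => fr.param (fr.coord (γ t)) :=
  funext fun s => (fr.param_coord (hγ.mem_surface s) fun hc => hfr hc s).symm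

theorem continuous_chart : Continuous fun s => fr.coord (γ s) :=
  continuous_iff_continuousAt.2 fun s =>
    ContinuousAt.comp (fr.contDiffAt_coord (coordDenom_pos hγ fr hfr s).ne').continuousAt
      hγ.continuous.continuousAt

theorem contDiffAt_chart {s : ℝ} (hs : ¬ IsSingularParam L S s) :
    ContDiffAt ℝ 2 (fun s => fr.coord (γ s)) s :=
  (fr.contDiffAt_coord (coordDenom_pos hγ fr hfr s).ne').comp s (hγ.contDiffAt s hs)

theorem hasDerivAt_chart {s : ℝ} (hs : ¬ IsSingularParam L S s) :
    HasDerivAt (fun s => fr.coord (γ s)) (deriv (fun s => fr.coord (γ s)) s) s :=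
  ((contDiffAt_chart hγ fr hfr hs).differentiableAt (by simp)).hasDerivAt

theorem deriv_chart {s : ℝ} (hs : ¬ IsSingularParam L S s) :
    deriv (fun s => fr.coord (γ s)) s = fderiv ℝ fr.coord (γ s) (deriv γ s) := by
  have h1 : HasDerivAt γ (deriv γ s) s :=
    ((hγ.contDiffAt s hs).differentiableAt (by simp)).hasDerivAt
  have h2 := (fr.contDiffAt_coord (coordDenom_pos hγ fr hfr s).ne').differentiableAt (by simp)
  exact (h2.hasFDerivAt.comp_hasDerivAt s h1).deriv

theorem deriv_eq_dparam {s : ℝ} (hs : ¬ IsSingularParam L S s) :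
    deriv γ s = fr.dparam (fr.coord (γ s)) (deriv (fun s => fr.coord (γ s)) s) := by
  have h := fr.hasDerivAt_param_comp (hasDerivAt_chart hγ fr hfr hs) (chart_mem hγ fr hfr s)
  rw [← eq_param_chart hγ fr hfr] at h
  exact h.deriv

theorem tendsto_deriv_chart {a : ℝ} {F : Filter ℝ} (hF : F ≤ 𝓝 a)
    (hns : ∀ᶠ t in F, ¬ IsSingularParam L S t) {v : Amb} (hv : Tendsto (deriv γ) F (𝓝 v)) :
    Tendsto (deriv fun s => fr.coord (γ s)) F (𝓝 (fderiv ℝ fr.coord (γ a) v)) := by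
  have h1 : Tendsto (fun t => fderiv ℝ fr.coord (γ t)) F (𝓝 (fderiv ℝ fr.coord (γ a))) :=
    (((fr.contDiffAt_coord (coordDenom_pos hγ fr hfr a).ne').continuousAt_fderiv
      (by simp)).tendsto.comp (hγ.continuous.tendsto a)).mono_left hF
  have h2 := (isBoundedBilinearMap_apply.continuous.tendsto (fderiv ℝ fr.coord (γ a), v)).comp
    (h1.prodMk_nhds hv)
  exact h2.congr' (hns.mono fun t ht => (deriv_chart hγ fr hfr ht).symm)

/-- Limits of the velocity on the surface and in the chart correspond to each other. -/
theorem tendsto_deriv_of_chart {a : ℝ} {F : Filter ℝ} (hF : F ≤ 𝓝 a)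
    (hns : ∀ᶠ t in F, ¬ IsSingularParam L S t) {h : ℂ}
    (hh : Tendsto (deriv fun s => fr.coord (γ s)) F (𝓝 h)) :
    Tendsto (deriv γ) F (𝓝 (fr.dparam (fr.coord (γ a)) h)) := by
  have h1 : Tendsto (fun t => fr.coord (γ t)) F (𝓝 (fr.coord (γ a))) :=
    ((continuous_chart hγ fr hfr).tendsto a).mono_left hF
  have h2 : ContinuousAt (fun q : ℂ × ℂ => fr.dparam q.1 q.2) (fr.coord (γ a), h) := by
    have hr : ContinuousAt (fun q : ℂ × ℂ => radialFactor c ‖q.1‖) (fr.coord (γ a), h) := by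
      unfold radialFactor
      exact ContinuousAt.inv₀ (by fun_prop) (ne_of_gt (chart_mem hγ fr hfr a))
    unfold Frame.dparam
    fun_prop
  exact (h2.tendsto.comp (h1.prodMk_nhds hh)).congr'
    (hns.mono fun t ht => (deriv_eq_dparam hγ fr hfr ht).symm)

theorem exists_chart_limits (a : ℝ) :
    (∃ h, Tendsto (deriv fun s => fr.coord (γ s)) (𝓝[<] a) (𝓝 h)) ∧
      ∃ h, Tendsto (deriv fun s => fr.coord (γ s)) (𝓝[>] a) (𝓝 h) := by
  obtain ⟨⟨u, hu⟩, v, hv⟩ := hγ.hasOneSidedLimits_deriv a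
  exact ⟨⟨_, tendsto_deriv_chart hγ fr hfr nhdsWithin_le_nhds (hγ.eventually_left a) hu⟩,
    _, tendsto_deriv_chart hγ fr hfr nhdsWithin_le_nhds (hγ.eventually_right a) hv⟩

theorem unit_speed_chart {s : ℝ} (hs : ¬ IsSingularParam L S s) :
    radialFactor c ‖fr.coord (γ s)‖ * ‖deriv (fun s => fr.coord (γ s)) s‖ = 1 := by
  have h := hγ.unit_speed s hs
  rw [deriv_eq_dparam hγ fr hfr hs, fr.form_dparam (chart_mem hγ fr hfr s), ← norm_sq_eq,
    ← mul_pow] at h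
  refine (pow_eq_one_iff_of_nonneg ?_ two_ne_zero).1 h
  exact mul_nonneg (radialFactor_pos (chart_mem hγ fr hfr s)).le (norm_nonneg _)

/-- The geodesic curvature is the derivative of the tangent angle in the chart, corrected by the
form `(c / 2) λ (x dy - y dx)`, where `λ` is the conformal factor. -/
theorem geodesicCurvature_chart {s : ℝ} (hs : ¬ IsSingularParam L S s) :
    geodesicCurvature c γ s
      = (deriv (deriv fun s => fr.coord (γ s)) s / deriv (fun s => fr.coord (γ s)) s).im
        - c / 2 * (radialFactor c ‖fr.coord (γ s)‖
          * ((starRingEnd ℂ) (fr.coord (γ s)) * deriv (fun s => fr.coord (γ s)) s).im) := by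
  conv_lhs => rw [eq_param_chart hγ fr hfr]
  rw [fr.geodesicCurvature_param_comp (contDiffAt_chart hγ fr hfr hs) (chart_mem hγ fr hfr s)]
  have hu := unit_speed_chart hγ fr hfr hs
  set z := fun s => fr.coord (γ s)
  change radialFactor c ‖z s‖ * _ = 1 at hu
  change radialFactor c ‖z s‖ ^ 2 * _ - c / 2 * radialFactor c ‖z s‖ ^ 3 * _
    * ((starRingEnd ℂ) (z s) * _).im = _ - c / 2 * (radialFactor c ‖z s‖
      * ((starRingEnd ℂ) (z s) * _).im)
  have hn : ‖deriv z s‖ ≠ 0 := fun h => by rw [h, mul_zero] at hu; exact zero_ne_one hu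
  have e : deriv (deriv z) s / deriv z s = ((‖deriv z s‖ ^ 2)⁻¹ : ℝ)
      * ((starRingEnd ℂ) (deriv z s) * deriv (deriv z) s) := by
    have h0 : deriv z s ≠ 0 := norm_ne_zero_iff.1 hn
    have h1 : ((‖deriv z s‖ : ℝ) : ℂ) ^ 2 = deriv z s * (starRingEnd ℂ) (deriv z s) := by
      rw [Complex.mul_conj, Complex.normSq_eq_norm_sq]; push_cast; rfl
    have h2 : (starRingEnd ℂ) (deriv z s) ≠ 0 := by simpa using h0
    push_cast
    rw [h1]
    field_simp
  rw [e, Complex.im_ofReal_mul]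
  have hr : (‖deriv z s‖ ^ 2)⁻¹ = radialFactor c ‖z s‖ ^ 2 := by
    rw [eq_inv_of_mul_eq_one_left hu, inv_pow]
  rw [hr]
  linear_combination (-(c / 2) * radialFactor c ‖z s‖
    * ((starRingEnd ℂ) (z s) * deriv z s).im * (radialFactor c ‖z s‖ * ‖deriv z s‖ + 1)) * hu

/-- In the chart the curve stays in a disc that is relatively compact in the domain. -/
theorem isClosedPlaneCurve : ∃ R M, 0 < 1 + c / 4 * R ^ 2 ∧
    IsClosedPlaneCurve L R M S (fun s => fr.coord (γ s)) := by
  have hz := continuous_chart hγ fr hfr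
  obtain ⟨s₀, -, hs₀⟩ := (isCompact_Icc (a := 0) (b := L)).exists_isMaxOn
    ⟨0, le_rfl, hγ.length_pos.le⟩ hz.norm.continuousOn
  have h1 : ∀ᶠ R in 𝓝 ‖fr.coord (γ s₀)‖, 0 < 1 + c / 4 * R ^ 2 :=
    (by fun_prop : Continuous fun R : ℝ => 1 + c / 4 * R ^ 2).continuousAt
      (lt_mem_nhds (chart_mem hγ fr hfr s₀))
  obtain ⟨R, hR, hR'⟩ := ((h1.filter_mono nhdsWithin_le_nhds).and
    (self_mem_nhdsWithin (s := Set.Ioi ‖fr.coord (γ s₀)‖))).exists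
  obtain ⟨M, hM⟩ := bounded_of_locally_bounded (f := deriv fun s => fr.coord (γ s))
    (isCompact_Icc (a := 0) (b := L)) fun s _ => by
      obtain ⟨⟨u, hu⟩, v, hv⟩ := exists_chart_limits hγ fr hfr s
      exact locally_bounded_of_limits hu hv
  refine ⟨R, M, hR, ⟨hγ.length_pos, S.countable_toSet, hz, fun s hs => ?_, hM, ?_, fun s hs => ?_⟩⟩
  · exact (hasDerivAt_chart hγ fr hfr (hγ.not_singular (Set.Ioo_subset_Ico_self hs.1)
      (by simpa using hs.2))).differentiableAt
  · have := hγ.periodic 0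
    simp only [zero_add] at this
    simp only [this]
  · exact (hs₀ hs).trans_lt hR'

end Chart

end IsClosedPiecewiseC2

/-! ### The tangent angle -/

theorem eventually_filter_lt_left (S : Finset ℝ) (a : ℝ) :
    ∀ᶠ t in 𝓝[<] a, S.filter (· < t) = S.filter (· < a) := by
  have h : ∀ b ∈ S, ∀ᶠ t in 𝓝[<] a, (b < t ↔ b < a) := by
    intro b _
    rcases lt_or_ge b a with hb | hb
    · filter_upwards [nhdsWithin_le_nhds (lt_mem_nhds hb)] with t ht using by simp [hb, ht]
    · filter_upwards [self_mem_nhdsWithin] with t ht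
      exact ⟨fun h => (not_lt.2 hb (h.trans ht)).elim, fun h => (not_lt.2 hb h).elim⟩
  filter_upwards [(S.eventually_all).2 h] with t ht
  exact Finset.filter_congr ht

theorem eventually_filter_lt_right (S : Finset ℝ) (a : ℝ) :
    ∀ᶠ t in 𝓝[>] a, S.filter (· < t) = S.filter (· ≤ a) := by
  have h : ∀ b ∈ S, ∀ᶠ t in 𝓝[>] a, (b < t ↔ b ≤ a) := by
    intro b _
    rcases le_or_gt b a with hb | hb
    · filter_upwards [self_mem_nhdsWithin] with t ht
      exact ⟨fun _ => hb, fun h => h.trans_lt ht⟩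
    · filter_upwards [nhdsWithin_le_nhds (gt_mem_nhds hb)] with t ht
      exact ⟨fun h => (lt_asymm h ht).elim, fun h => (not_lt.2 h hb).elim⟩
  filter_upwards [(S.eventually_all).2 h] with t ht
  exact Finset.filter_congr ht

theorem sum_filter_le (S : Finset ℝ) (f : ℝ → ℝ) (a : ℝ) :
    ∑ b ∈ S.filter (· ≤ a), f b = ∑ b ∈ S.filter (· < a), f b + if a ∈ S then f a else 0 := by
  simp only [Finset.sum_filter]
  have : (if a ∈ S then f a else 0) = ∑ b ∈ S, if b = a then f b else 0 := by simp
  rw [this, ← Finset.sum_add_distrib]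
  refine Finset.sum_congr rfl fun b _ => ?_
  rcases lt_trichotomy b a with h | h | h
  · simp [h, h.le, h.ne]
  · simp [h]
  · simp [h.not_ge, h.not_gt, h.ne']

namespace IsClosedPiecewiseC2

variable (hγ : IsClosedPiecewiseC2 c L S γ) (fr : Frame c) (hfr : 0 < c → ∀ s, γ s ≠ -fr.pt)

/-- The two velocities at a corner, read in the chart as complex numbers, differ by the factor
`exp (i (π - θ))`. -/
theorem unit_tangent_jump (hγ : IsClosedPiecewiseC2 c L S γ)
    (hfr : 0 < c → ∀ s, γ s ≠ -fr.pt) {a θ : ℝ} (hθ : IsInteriorAngle c γ a θ) {h k : ℂ}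
    (hh : Tendsto (deriv fun s => fr.coord (γ s)) (𝓝[<] a) (𝓝 h))
    (hk : Tendsto (deriv fun s => fr.coord (γ s)) (𝓝[>] a) (𝓝 k))
    (hu : radialFactor c ‖fr.coord (γ a)‖ * ‖k‖ = 1) :
    k * Complex.exp (-((Real.pi - θ : ℝ) : ℂ) * Complex.I) = h := by
  obtain ⟨-, -, Ti, To, hTi, hTo, hcos, hsin⟩ := hθ
  have e1 := tendsto_nhds_unique hTi (tendsto_deriv_of_chart hγ fr hfr nhdsWithin_le_nhds
    (hγ.eventually_left a) hh)
  have e2 := tendsto_nhds_unique hTo (tendsto_deriv_of_chart hγ fr hfr nhdsWithin_le_nhds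
    (hγ.eventually_right a) hk)
  have hmem := chart_mem hγ fr hfr a
  rw [congrFun (eq_param_chart hγ fr hfr) a] at hsin
  rw [e1, e2, ← fr.dparam_neg] at hcos hsin
  rw [fr.form_dparam hmem] at hcos
  rw [fr.areaForm_dparam hmem] at hsin
  set r := radialFactor c ‖fr.coord (γ a)‖
  have hu2 : r ^ 2 * (k.re * k.re + k.im * k.im) = 1 := by
    rw [← norm_sq_eq, ← mul_pow, hu, one_pow]
  have hexp : Complex.exp (-((Real.pi - θ : ℝ) : ℂ) * Complex.I)
      = ⟨-Real.cos θ, -Real.sin θ⟩ := by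
    rw [← Complex.ofReal_neg, Complex.exp_mul_I, ← Complex.ofReal_cos, ← Complex.ofReal_sin,
      show -(Real.pi - θ) = θ - Real.pi by ring, Real.cos_sub_pi, Real.sin_sub_pi]
    apply Complex.ext <;> simp [Complex.cos_ofReal_re, Complex.sin_ofReal_re]
  rw [hexp, ← hcos, ← hsin]
  simp only [Complex.neg_re, Complex.neg_im]
  apply Complex.ext
  · simp only [Complex.mul_re]
    linear_combination h.re * hu2
  · simp only [Complex.mul_im]
    linear_combination h.im * hu2

include hγ hfr in
theorem continuous_radialFactor_chart :
    Continuous fun s => radialFactor c ‖fr.coord (γ s)‖ := by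
  unfold radialFactor
  have := continuous_chart hγ fr hfr
  exact Continuous.inv₀ (by fun_prop) fun s => ne_of_gt (chart_mem hγ fr hfr s)

include hγ hfr in
/-- One-sided limits of the velocity are unit vectors of the conformal metric. -/
theorem unit_of_tendsto {a : ℝ} {F : Filter ℝ} [F.NeBot] (hF : F ≤ 𝓝 a)
    (hns : ∀ᶠ t in F, ¬ IsSingularParam L S t) {h : ℂ}
    (hh : Tendsto (deriv fun s => fr.coord (γ s)) F (𝓝 h)) :
    radialFactor c ‖fr.coord (γ a)‖ * ‖h‖ = 1 := by
  have h1 := (continuous_radialFactor_chart hγ fr hfr).tendsto a |>.mono_left hF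
  refine tendsto_nhds_unique (h1.mul hh.norm) ?_
  exact tendsto_const_nhds.congr'
    (hns.mono fun t ht => (unit_speed_chart hγ fr hfr ht).symm)

/-- A continuous tangent angle with the jumps removed: the velocity in the chart, rotated back at
each corner already passed by the turning angle there, extends continuously to `[0, L]` and has a
continuous argument `ψ`. -/
theorem exists_tangent_angle (hγ : IsClosedPiecewiseC2 c L S γ) (fr : Frame c)
    (hfr : 0 < c → ∀ s, γ s ≠ -fr.pt) {θ : ℝ → ℝ} (hθ : ∀ a ∈ S, IsInteriorAngle c γ a (θ a)) :
    ∃ ψ : ℝ → ℝ, Continuous ψ ∧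
      (∀ s ∈ Set.Ioo 0 L, s ∉ S → HasDerivAt ψ
        (deriv (deriv fun s => fr.coord (γ s)) s / deriv (fun s => fr.coord (γ s)) s).im s) ∧
      ∃ ν : ℤ, ψ L - ψ 0 = ∑ a ∈ S, θ a + (2 * (ν : ℝ) - (S.card : ℝ)) * Real.pi := by
  choose u hu using fun a => (exists_chart_limits hγ fr hfr a).1
  choose v hv using fun a => (exists_chart_limits hγ fr hfr a).2
  set z := fun s => fr.coord (γ s) with hz
  have hu0 : ∀ a, u a ≠ 0 := fun a h0 => by
    have := unit_of_tendsto hγ fr hfr nhdsWithin_le_nhds (hγ.eventually_left a) (hu a)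
    simp [h0] at this
  have hreg : ∀ s, ¬ IsSingularParam L S s → ContDiffAt ℝ 1 (deriv z) s := fun s hs =>
    ContDiffAt.derivWithin (m := 1) (contDiffAt_chart hγ fr hfr hs) (by norm_num)
  have hreg_u : ∀ s, ¬ IsSingularParam L S s → u s = deriv z s := fun s hs =>
    tendsto_nhds_unique (hu s) ((hreg s hs).continuousAt.tendsto.mono_left nhdsWithin_le_nhds)
  have hreg_v : ∀ s, ¬ IsSingularParam L S s → v s = deriv z s := fun s hs =>
    tendsto_nhds_unique (hv s) ((hreg s hs).continuousAt.tendsto.mono_left nhdsWithin_le_nhds)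
  have huL : u L = u 0 := by
    have hp : Function.Periodic z L := fun s => by simp only [hz, hγ.periodic s]
    have := (tendsto_periodic (periodic_deriv hp) 1 0).1 (hu 0)
    rw [zero_add, Int.cast_one, one_mul] at this
    exact tendsto_nhds_unique (hu L) this
  set E : Finset ℝ → ℂ := fun A =>
    Complex.exp (-((∑ b ∈ A, (Real.pi - θ b) : ℝ) : ℂ) * Complex.I) with hE
  set V : ℝ → ℂ := fun t => u t * E (S.filter (· < t)) with hV
  have hleft : ∀ a, Tendsto V (𝓝[<] a) (𝓝 (V a)) := by
    intro a
    refine ((hu a).mul (tendsto_const_nhds (x := E (S.filter (· < a))))).congr' ?_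
    filter_upwards [hγ.eventually_left a, eventually_filter_lt_left S a] with t h1 h2
    simp only [hV, h2, hreg_u t h1]
  have hright : ∀ a ∈ Set.Ico 0 L, Tendsto V (𝓝[>] a) (𝓝 (V a)) := by
    intro a ha
    -- the rotation by the exterior angle at `a` makes the two one-sided limits agree
    have hva : v a * E (S.filter (· ≤ a)) = V a := by
      simp only [hE, hV, sum_filter_le]
      by_cases haS : a ∈ S
      · rw [if_pos haS, Complex.ofReal_add, neg_add, add_mul, Complex.exp_add]
        have := unit_tangent_jump fr hγ hfr (hθ a haS) (hu a) (hv a)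
          (unit_of_tendsto hγ fr hfr nhdsWithin_le_nhds (hγ.eventually_right a) (hv a))
        rw [← this]
        ring
      · have := hγ.not_singular ha haS
        rw [if_neg haS, add_zero, hreg_u a this, hreg_v a this]
    rw [← hva]
    refine ((hv a).mul (tendsto_const_nhds (x := E (S.filter (· ≤ a))))).congr' ?_
    filter_upwards [hγ.eventually_right a, eventually_filter_lt_right S a] with t h1 h2
    simp only [hV, h2, hreg_u t h1]
  have hcont : ContinuousOn V (Set.Icc 0 L) := by
    intro a ha
    have h1 : ContinuousWithinAt V (Set.Iic a) a := continuousWithinAt_Iio_iff_Iic.1 (hleft a)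
    rcases ha.2.lt_or_eq with h | h
    · have h2 : ContinuousWithinAt V (Set.Ici a) a :=
        continuousWithinAt_Ioi_iff_Ici.1 (hright a ⟨ha.1, h⟩)
      exact (continuousAt_iff_continuous_left_right.2 ⟨h1, h2⟩).continuousWithinAt
    · exact h1.mono fun t ht => ht.2.trans h.ge
  have hV0 : ∀ s, V s ≠ 0 := fun s => mul_ne_zero (hu0 s) (Complex.exp_ne_zero _)
  obtain ⟨f, hf, hfV⟩ := exists_continuous_log hγ.length_pos.le hcont fun s _ => hV0 s
  have hψ : Continuous fun s => (f s).im := Complex.continuous_im.comp hf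
  refine ⟨_, hψ, fun s hs hsS => ?_, ?_⟩
  · have hns := hγ.not_singular (Set.Ioo_subset_Ico_self hs) hsS
    have hloc : V =ᶠ[𝓝 s] fun t => deriv z t * E (S.filter (· < s)) := by
      have hr : S.filter (· ≤ s) = S.filter (· < s) :=
        Finset.filter_congr fun b hb =>
          ⟨fun h => lt_of_le_of_ne h fun e => hsS (e ▸ hb), le_of_lt⟩
      have h1 := eventually_filter_lt_left S s
      have h2 := eventually_filter_lt_right S s
      rw [hr] at h2
      have h3 : ∀ᶠ t in 𝓝 s, S.filter (· < t) = S.filter (· < s) := by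
        rw [← pure_sup_nhdsNE, ← Set.Iio_union_Ioi, nhdsWithin_union]
        exact eventually_sup.2 ⟨rfl, eventually_sup.2 ⟨h1, h2⟩⟩
      filter_upwards [h3, hγ.eventually_nhds_not_singular hns] with t h4 h5
      simp only [hV, h4, hreg_u t h5]
    have hd : HasDerivAt V (deriv (deriv z) s * E (S.filter (· < s))) s :=
      ((((hreg s hns).differentiableAt (by simp)).hasDerivAt).mul_const _).congr_of_eventuallyEq
        hloc
    have h := hasDerivAt_argument hd (hV0 s) hψ.continuousAt (by
      filter_upwards [Icc_mem_nhds hs.1 hs.2] with t ht using eq_norm_mul_exp_im (hfV t ht))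
    rwa [hloc.self_of_nhds, mul_div_mul_right _ _ (Complex.exp_ne_zero _)] at h
  · have h0 : S.filter (· < (0 : ℝ)) = ∅ :=
      Finset.filter_eq_empty_iff.2 fun b hb => not_lt.2 (hγ.singular_mem b hb).1
    have hL : S.filter (· < L) = S :=
      Finset.filter_eq_self.2 fun b hb => (hγ.singular_mem b hb).2
    have e0 := hfV 0 ⟨le_rfl, hγ.length_pos.le⟩
    have eL := hfV L ⟨hγ.length_pos.le, le_rfl⟩
    simp only [hV, h0, hL, hE, huL, Finset.sum_empty] at e0 eL
    simp only [Complex.ofReal_zero, neg_zero, zero_mul, Complex.exp_zero, mul_one] at e0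
    rw [← e0, ← Complex.exp_add, Complex.exp_eq_exp_iff_exists_int] at eL
    obtain ⟨n, hn⟩ := eL
    refine ⟨n, ?_⟩
    have him := congrArg Complex.im hn
    simp only [Complex.add_im, Complex.mul_im, Complex.neg_re, Complex.neg_im, Complex.ofReal_re,
      Complex.ofReal_im, Complex.I_re, Complex.I_im, Complex.intCast_re, Complex.intCast_im,
      Complex.mul_re, Complex.re_ofNat, Complex.im_ofNat] at him
    rw [him, Finset.sum_sub_distrib, Finset.sum_const, nsmul_eq_mul]
    ring

end IsClosedPiecewiseC2

end ConstCurv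

theorem theorem6p1 (c L : ℝ) (S : Finset ℝ) (γ : ℝ → ConstCurv.Amb)
    (hγ : ConstCurv.IsClosedPiecewiseC2 c L S γ)
    (θ : ℝ → ℝ) (hθ : ∀ a ∈ S, ConstCurv.IsInteriorAngle c γ a (θ a))
    (fr : ConstCurv.Frame c) (hfr : 0 < c → ∀ s, γ s ≠ -fr.pt) :
    Integrable (fr.index L γ) fr.areaMeasure ∧
    ((∀ a ∈ S, ConstCurv.HasOneSidedLimits (deriv (deriv γ)) a) →
      IntervalIntegrable (ConstCurv.geodesicCurvature c γ) volume 0 L) ∧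
    ∃ ν : ℤ,
      (IntervalIntegrable (ConstCurv.geodesicCurvature c γ) volume 0 L →
        ∫ s in (0 : ℝ)..L, ConstCurv.geodesicCurvature c γ s =
          -c * fr.areaWithMult L γ + ∑ a ∈ S, θ a + (2 * (ν : ℝ) - (S.card : ℝ)) * Real.pi) ∧
      ConstCurv.HasImproperIntegral (ConstCurv.geodesicCurvature c γ) L S
        (-c * fr.areaWithMult L γ + ∑ a ∈ S, θ a + (2 * (ν : ℝ) - (S.card : ℝ)) * Real.pi) := by
  open ConstCurv IsClosedPiecewiseC2 in
  obtain ⟨R, M, hR, hz⟩ := isClosedPlaneCurve hγ fr hfr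
  have hInt := hz.integrableOn_planeIndex hR
  refine ⟨fr.integrable_areaMeasure hInt, hγ.intervalIntegrable_geodesicCurvature, ?_⟩
  have hF : fr.areaWithMult L γ = _ :=
    (fr.integral_areaMeasure hInt).trans (hz.integral_planeIndex hR)
  obtain ⟨ψ, hψ, hψ', ν, hν⟩ := exists_tangent_angle hγ fr hfr hθ
  -- the form `λ (x dy - y dx)`, whose integral is twice the area by Green's formula
  set ω : ℝ → ℝ := fun s => radialFactor c ‖fr.coord (γ s)‖
    * ((starRingEnd ℂ) (fr.coord (γ s)) * deriv (fun s => fr.coord (γ s)) s).im with hω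
  have hωi : IntervalIntegrable ω volume 0 L := by
    have h1 : IntervalIntegrable (fun s => (starRingEnd ℂ) (fr.coord (γ s))
        * deriv (fun s => fr.coord (γ s)) s) volume 0 L :=
      hz.intervalIntegrable_deriv.continuousOn_mul
        (Complex.continuous_conj.comp (continuous_chart hγ fr hfr)).continuousOn
    have h2 : IntervalIntegrable (fun s => ((starRingEnd ℂ) (fr.coord (γ s))
        * deriv (fun s => fr.coord (γ s)) s).im) volume 0 L := ⟨h1.1.im, h1.2.im⟩
    exact h2.continuousOn_mul (continuous_radialFactor_chart hγ fr hfr).continuousOn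
  have hωm : Measurable ω := by
    have hzc := continuous_chart hγ fr hfr
    exact (continuous_radialFactor_chart hγ fr hfr).measurable.mul (Complex.measurable_im.comp
      ((Complex.continuous_conj.comp hzc).measurable.mul (measurable_deriv _)))
  set K : ℝ → ℝ := fun s => ψ s - c / 2 * ∫ t in (0 : ℝ)..s, ω t with hK
  have hKc : ContinuousOn K (Set.Icc 0 L) := by
    refine hψ.continuousOn.sub (continuousOn_const.mul ?_)
    have := intervalIntegral.continuousOn_primitive_interval' hωi Set.left_mem_uIcc
    rwa [Set.uIcc_of_le hγ.length_pos.le] at this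
  have hKd : ∀ s ∈ Set.Ioo 0 L, s ∉ S → HasDerivAt K (geodesicCurvature c γ s) s := by
    intro s hs hsS
    have hns := hγ.not_singular (Set.Ioo_subset_Ico_self hs) hsS
    have hωc : ContinuousAt ω s := by
      have h1 : ContinuousAt (deriv fun s => fr.coord (γ s)) s :=
        (ContDiffAt.derivWithin (m := 1) (contDiffAt_chart hγ fr hfr hns)
          (by norm_num)).continuousAt
      exact (continuous_radialFactor_chart hγ fr hfr).continuousAt.mul
        (Complex.continuous_im.continuousAt.comp
          ((Complex.continuous_conj.comp (continuous_chart hγ fr hfr)).continuousAt.mul h1))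
    have hωs : IntervalIntegrable ω volume 0 s := hωi.mono_set (by
      rw [Set.uIcc_of_le hs.1.le, Set.uIcc_of_le hγ.length_pos.le]
      exact Set.Icc_subset_Icc le_rfl hs.2.le)
    have h2 := intervalIntegral.integral_hasDerivAt_right hωs
      (hωm.stronglyMeasurable.stronglyMeasurableAtFilter) hωc
    rw [geodesicCurvature_chart hγ fr hfr hns]
    exact (hψ' s hs hsS).sub (h2.const_mul _)
  have hKL : K L - K 0
      = -c * fr.areaWithMult L γ + ∑ a ∈ S, θ a + (2 * (ν : ℝ) - (S.card : ℝ)) * Real.pi := by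
    rw [hF]
    simp only [hK, intervalIntegral.integral_same]
    linear_combination hν
  refine ⟨ν, fun hi => ?_, K, hKc, hKd, hKL⟩
  rw [← hKL]
  exact integral_eq_of_hasDerivAt_off_countable_of_le K _ hγ.length_pos.le S.countable_toSet hKc
    (fun s hs => hKd s hs.1 (by simpa using hs.2)) hi
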